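/- For an integer $d\ge 2$, a function $\Phi\in C^\infty(\mathbb{R}^d\setminus\{0\},\mathbb{R})$ that is homogeneous of degree $0$ (that is, $\Phi(r\xi)=\Phi(\xi)$ for all $r>0$, $\xi\ne 0$) and $t\in\mathbb{R}$, let $T_\Phi^t$ be the Fourier multiplier operator with symbol $e^{it\Phi(\xi)}$, defined on Schwartz functions $f\in\mathcal{S}(\mathbb{R}^d)$ by \[T_\Phi^t f(x)=\int_{\mathbb{R}^d}e^{it\Phi(\xi)+i\xi\cdot x}\,\widehat f(\xi)\,d\xi,\qquad \widehat f(\xi)=\frac1{(2\pi)^d}\int_{\mathbb{R}^d}f(x)e^{-i\xi\cdot x}\,dx,\] and let $\|T_\Phi^t\|_{L^p\to L^p}=\sup\{\|T_\Phi^tf\|_{L^p}/\|f\|_{L^p}: f\in\mathcal{S}(\mathbb{R}^d),\ f\neq 0\}$ be its norm on $L^p(\mathbb{R}^d)$. Write $\langle t\rangle=(1+|t|^2)^{1/2}$. Theorem. Let $d\ge 2$ be an integer, let $p\in(1,\infty)$, and let $\Phi\in C^\infty(\mathbb{R}^d\setminus\{0\},\mathbb{R})$ be homogeneous of degree $0$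 and such that the restriction $\Phi|_{S^{d-1}}$ to the unit sphere has a nondegenerate local minimum or a nondegenerate local maximum, i.e. a local minimum or maximum at some point $q\in S^{d-1}$ such that, for some smooth local chart $\psi$ of $S^{d-1}$ at $q$, the gradient of $\Phi|_{S^{d-1}}\circ\psi^{-1}$ vanishes at $\psi(q)$ and its Hessian matrix at $\psi(q)$ is invertible. Then there exists a constant $c_{d,p,\Phi}>0$, depending only on $d$, $p$ and $\Phi$, such that for all $t\in\mathbb{R}$ \[\|T_\Phi^t\|_{L^p(\mathbb{R}^d)\to L^p(\mathbb{R}^d)}\ \ge\ c_{d,p,\Phi}\,\langle t\rangle^{d\left|\frac12-\frac1p\right|}.\] -/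

import Mathlib

open MeasureTheory
open scoped ENNReal Manifold ContDiff SchwartzMap

noncomputable section

/-- The Fourier transform with the normalization
`f̂(ξ) = (2π)^{-d} ∫ f(x) e^{-i ξ·x} dx`. -/
def fourierHat {d : ℕ} (f : EuclideanSpace ℝ (Fin d) → ℂ) (ξ : EuclideanSpace ℝ (Fin d)) : ℂ :=
  (1 / (2 * (Real.pi : ℂ)) ^ d) *
    ∫ x, f x * Complex.exp (-(Complex.I * ((inner ℝ ξ x : ℝ) : ℂ)))

/-- The multiplier operator with symbol `e^{itΦ}` on Schwartz functions:
`T_Φ^t f(x) = ∫ e^{itΦ(ξ) + i ξ·x} f̂(ξ) dξ`. -/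
def multiplierOp {d : ℕ} (Φ : EuclideanSpace ℝ (Fin d) → ℝ) (t : ℝ)
    (f : 𝓢(EuclideanSpace ℝ (Fin d), ℂ)) (x : EuclideanSpace ℝ (Fin d)) : ℂ :=
  ∫ ξ, Complex.exp (Complex.I * (t : ℂ) * (Φ ξ : ℂ) + Complex.I * ((inner ℝ ξ x : ℝ) : ℂ)) *
    fourierHat f ξ

/-- The `L^p → L^p` norm of `T_Φ^t`: the supremum of `‖T_Φ^t f‖_p / ‖f‖_p` over nonzero Schwartz
functions, with values in `[0, ∞]`. -/
def multiplierNorm {d : ℕ} (Φ : EuclideanSpace ℝ (Fin d) → ℝ) (t p : ℝ) : ℝ≥0∞ :=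
  ⨆ (f : 𝓢(EuclideanSpace ℝ (Fin d), ℂ)) (_ : f ≠ 0),
    eLpNorm (multiplierOp Φ t f) (ENNReal.ofReal p) volume /
      eLpNorm f (ENNReal.ofReal p) volume

/-- The Japanese bracket of a real number. -/
def japaneseBracket (t : ℝ) : ℝ := Real.sqrt (1 + |t| ^ 2)

/-- The Hessian matrix of second partial derivatives. -/
def hessianMatrix {n : ℕ} (g : EuclideanSpace ℝ (Fin n) → ℝ) (x : EuclideanSpace ℝ (Fin n)) :
    Matrix (Fin n) (Fin n) ℝ :=
  Matrix.of fun j k =>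
    fderiv ℝ (fun y => fderiv ℝ g y (EuclideanSpace.single k 1)) x (EuclideanSpace.single j 1)

/-- `q` is a nondegenerate critical point of `f : M → ℝ`: in some smooth local chart at `q` the
gradient of `f` vanishes and its Hessian matrix is regular. -/
def IsNondegenerateCriticalPoint {n : ℕ} {M : Type*} [TopologicalSpace M]
    [ChartedSpace (EuclideanSpace ℝ (Fin n)) M] (f : M → ℝ) (q : M) : Prop :=
  ∃ ψ ∈ IsManifold.maximalAtlas (𝓡 n) ∞ M, q ∈ ψ.source ∧
    fderiv ℝ (f ∘ ψ.symm) (ψ q) = 0 ∧ IsUnit (hessianMatrix (f ∘ ψ.symm) (ψ q))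

/-- `f` has a nondegenerate local minimum or maximum. -/
def HasNondegenerateLocalExtremum (n : ℕ) {M : Type*} [TopologicalSpace M]
    [ChartedSpace (EuclideanSpace ℝ (Fin n)) M] (f : M → ℝ) : Prop :=
  ∃ q : M, (IsLocalMin f q ∨ IsLocalMax f q) ∧ IsNondegenerateCriticalPoint (n := n) f q

end

/-! The lower bound comes from wave packets that disperse at the rate of a nondegenerate phase in
all `d` variables. The Hessian of `Φ` at the extremum `q` is degenerate: it kills the radial
direction. It is however definite on `q^⊥`, and this persists nearby. Differentiating Euler's
identity shows that where it persists and `∇Φ(ξ) ≠ 0`, the full Hessian is injective. Such `ξ` exist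
arbitrarily close to `q`, since a gradient vanishing identically near `q` would make the Hessian
vanish there (`exists_injective_fderiv_fderiv`).

Let `ξ₀` be such a point, `χ` a bump near it, and `K t` the function with Fourier transform `e^{itΦ}
χ`. Then `T^t (K s) = K (s + t)`, the `L²` norm of `K t` is constant, and `‖K t‖_∞ ≲ ⟨t⟩^{-d/2}`
(`exists_dispersive_bound`). Comparing `L^p` with `L²` and `L^∞` shows that `‖K t‖_p` is at least a
multiple of `⟨t⟩^{d(1/p-1/2)}` for `p ≤ 2` and at most such a multiple for `p ≥ 2`. The test
functions are `K 0`, carried to `K t`, in the first case, and `K (-t)`, refocused to `K 0`, in the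
second.

The dispersive estimate avoids the Morse lemma. The squared Fourier integral is at most the integral
over `h` of the modulus of the autocorrelation of `e^{itΦ} χ`. The latter is an oscillatory integral
with phase `t (Φ(ξ+h) - Φ(ξ))`, whose gradient has size about `|t| ‖h‖` because the Hessian is
injective. Nonstationary phase bounds it by `(1 + |t| ‖h‖)^{-N}`, and integrating in `h` gives
`|t|^{-d}`. -/

/-! ### Nonstationary phase, uniform over families -/

section NonstationaryPhase

variable {E : Type*} [NormedAddCommGroup E] [NormedSpace ℝ E] {ι : Type*}

/-- The directional derivative of `u` in the direction `e`. -/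
noncomputable def dirDeriv (e : E) (u : E → ℂ) : E → ℂ := fun x => fderiv ℝ u x e

/-- The functions `u i` and their derivatives in the direction `e i` up to order `n` are bounded
on `U`, uniformly in `i`. -/
def BoundedDirDerivs (U : Set E) (e : ι → E) : ℕ → (ι → E → ℂ) → Prop
  | 0, u => ∃ C : ℝ, ∀ i, ∀ x ∈ U, ‖u i x‖ ≤ C
  | n + 1, u => (∃ C : ℝ, ∀ i, ∀ x ∈ U, ‖u i x‖ ≤ C) ∧
      BoundedDirDerivs U e n (fun i => dirDeriv (e i) (u i))

variable {U : Set E} {e : ι → E} {u v : ι → E → ℂ} {n : ℕ}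

lemma BoundedDirDerivs.bounded (h : BoundedDirDerivs U e n u) :
    ∃ C : ℝ, ∀ i, ∀ x ∈ U, ‖u i x‖ ≤ C := by
  cases n with
  | zero => exact h
  | succ n => exact h.1

lemma BoundedDirDerivs.of_succ (h : BoundedDirDerivs U e (n + 1) u) :
    BoundedDirDerivs U e n u := by
  induction n generalizing u with
  | zero => exact h.1
  | succ n ih => exact ⟨h.1, ih h.2⟩

lemma dirDeriv_eqOn (hU : IsOpen U) {e : E} {u v : E → ℂ} (h : Set.EqOn u v U) :
    Set.EqOn (dirDeriv e u) (dirDeriv e v) U := by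
  intro x hx
  have : u =ᶠ[nhds x] v := by
    filter_upwards [hU.mem_nhds hx] with y hy using h hy
  simp only [dirDeriv, this.fderiv_eq]

lemma BoundedDirDerivs.congr (hU : IsOpen U) (h : BoundedDirDerivs U e n u)
    (huv : ∀ i, Set.EqOn (u i) (v i) U) : BoundedDirDerivs U e n v := by
  induction n generalizing u v with
  | zero =>
    obtain ⟨C, hC⟩ := h
    exact ⟨C, fun i x hx => by rw [← huv i hx]; exact hC i x hx⟩
  | succ n ih =>
    obtain ⟨⟨C, hC⟩, h2⟩ := h
    exact ⟨⟨C, fun i x hx => by rw [← huv i hx]; exact hC i x hx⟩,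
      ih h2 fun i => dirDeriv_eqOn hU (huv i)⟩

lemma ContDiffOn.dirDeriv (hU : IsOpen U) {e : E} {u : E → ℂ} (h : ContDiffOn ℝ ∞ u U) :
    ContDiffOn ℝ ∞ (dirDeriv e u) U :=
  (h.fderiv_of_isOpen hU (by simp)).clm_apply contDiffOn_const

lemma ContDiffOn.differentiableAt_of_isOpen (hU : IsOpen U) {u : E → ℂ}
    (h : ContDiffOn ℝ ∞ u U) {x : E} (hx : x ∈ U) : DifferentiableAt ℝ u x :=
  (h.contDiffAt (hU.mem_nhds hx)).differentiableAt (by simp)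

lemma BoundedDirDerivs.add (hU : IsOpen U) (hu : BoundedDirDerivs U e n u)
    (hv : BoundedDirDerivs U e n v) (hu' : ∀ i, ContDiffOn ℝ ∞ (u i) U)
    (hv' : ∀ i, ContDiffOn ℝ ∞ (v i) U) :
    BoundedDirDerivs U e n (fun i x => u i x + v i x) := by
  have key : ∃ C : ℝ, ∀ i, ∀ x ∈ U, ‖u i x + v i x‖ ≤ C := by
    obtain ⟨C, hC⟩ := hu.bounded
    obtain ⟨D, hD⟩ := hv.bounded
    exact ⟨C + D, fun i x hx => (norm_add_le _ _).trans (add_le_add (hC i x hx) (hD i x hx))⟩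
  induction n generalizing u v with
  | zero => exact key
  | succ n ih =>
    refine ⟨key, ?_⟩
    have := ih hu.2 hv.2 (fun i => (hu' i).dirDeriv hU) (fun i => (hv' i).dirDeriv hU) ?_
    · refine this.congr hU fun i x hx => ?_
      simp only [dirDeriv]
      rw [fderiv_fun_add ((hu' i).differentiableAt_of_isOpen hU hx)
        ((hv' i).differentiableAt_of_isOpen hU hx)]
      rfl
    · obtain ⟨C, hC⟩ := hu.2.bounded
      obtain ⟨D, hD⟩ := hv.2.bounded
      exact ⟨C + D, fun i x hx => (norm_add_le _ _).trans (add_le_add (hC i x hx) (hD i x hx))⟩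

lemma BoundedDirDerivs.mul (hU : IsOpen U) (hu : BoundedDirDerivs U e n u)
    (hv : BoundedDirDerivs U e n v) (hu' : ∀ i, ContDiffOn ℝ ∞ (u i) U)
    (hv' : ∀ i, ContDiffOn ℝ ∞ (v i) U) :
    BoundedDirDerivs U e n (fun i x => u i x * v i x) := by
  induction n generalizing u v with
  | zero =>
    obtain ⟨C, hC⟩ := hu
    obtain ⟨D, hD⟩ := hv
    refine ⟨C * D, fun i x hx => ?_⟩
    rw [norm_mul]
    exact mul_le_mul (hC i x hx) (hD i x hx) (norm_nonneg _) ((norm_nonneg _).trans (hC i x hx))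
  | succ n ih =>
    refine ⟨(ih hu.of_succ hv.of_succ hu' hv').bounded, ?_⟩
    have h1 := ih hu.of_succ hv.2 hu' (fun i => (hv' i).dirDeriv hU)
    have h2 := ih hu.2 hv.of_succ (fun i => (hu' i).dirDeriv hU) hv'
    refine (h1.add hU h2 (fun i => (hu' i).mul ((hv' i).dirDeriv hU))
      (fun i => ((hu' i).dirDeriv hU).mul (hv' i))).congr hU fun i x hx => ?_
    simp only [dirDeriv]
    rw [fderiv_fun_mul ((hu' i).differentiableAt_of_isOpen hU hx)
      ((hv' i).differentiableAt_of_isOpen hU hx)]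
    simp [mul_comm]

lemma BoundedDirDerivs.inv (hU : IsOpen U) (hu : BoundedDirDerivs U e n u)
    (hu' : ∀ i, ContDiffOn ℝ ∞ (u i) U) {c : ℝ} (hc : 0 < c)
    (hlow : ∀ i, ∀ x ∈ U, c ≤ ‖u i x‖) :
    BoundedDirDerivs U e n (fun i x => (u i x)⁻¹) := by
  have hne : ∀ i, ∀ x ∈ U, u i x ≠ 0 := fun i x hx =>
    norm_pos_iff.1 (hc.trans_le (hlow i x hx))
  have hbd : ∃ C : ℝ, ∀ i, ∀ x ∈ U, ‖(u i x)⁻¹‖ ≤ C := by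
    refine ⟨c⁻¹, fun i x hx => ?_⟩
    rw [norm_inv]
    exact inv_anti₀ hc (hlow i x hx)
  have hsm : ∀ i, ContDiffOn ℝ ∞ (fun x => (u i x)⁻¹) U := fun i => (hu' i).inv (hne i)
  induction n with
  | zero => exact hbd
  | succ n ih =>
    refine ⟨hbd, ?_⟩
    have h1 := ih hu.of_succ
    have h2 := h1.mul hU h1 hsm hsm
    have h3 := h2.mul hU hu.2 (fun i => (hsm i).mul (hsm i)) (fun i => (hu' i).dirDeriv hU)
    -- The sign in `∂(1/u) = -u⁻² ∂u`, treated as one more bounded factor.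
    have h4 : BoundedDirDerivs U e n (fun _ _ => (-1 : ℂ)) := by
      clear * -
      have : ∀ z : ℂ, BoundedDirDerivs U e n (fun _ _ => z) := by
        induction n with
        | zero => exact fun z => ⟨‖z‖, fun _ _ _ => le_rfl⟩
        | succ n ih =>
          refine fun z => ⟨⟨‖z‖, fun _ _ _ => le_rfl⟩, ?_⟩
          have h0 : (fun i : ι => dirDeriv (e i) (fun _ => z)) = fun _ _ => 0 := by
            ext i x
            simp [dirDeriv]
          rw [h0]
          exact ih 0
      exact this _
    refine (h4.mul hU h3 (fun i => contDiffOn_const)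
      (fun i => ((hsm i).mul (hsm i)).mul ((hu' i).dirDeriv hU))).congr hU fun i x hx => ?_
    have h5 : HasFDerivAt (fun y => (u i y)⁻¹) _ x :=
      (hasDerivAt_inv (hne i x hx)).comp_hasFDerivAt x
        ((hu' i).differentiableAt_of_isOpen hU hx).hasFDerivAt
    simp only [dirDeriv]
    rw [h5.fderiv]
    simp only [smul_apply, smul_eq_mul]
    field_simp [hne i x hx]

lemma contDiff_mul_of_tsupport_subset (hU : IsOpen U) {a b : E → ℂ} (ha : ContDiff ℝ ∞ a)
    (hb : ContDiffOn ℝ ∞ b U) (hs : tsupport a ⊆ U) : ContDiff ℝ ∞ (fun x => a x * b x) := by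
  rw [contDiff_iff_contDiffAt]
  intro x
  by_cases hx : x ∈ tsupport a
  · exact ha.contDiffAt.mul (hb.contDiffAt (hU.mem_nhds (hs hx)))
  · have : (fun x => a x * b x) =ᶠ[nhds x] fun _ => 0 := by
      filter_upwards [(isClosed_tsupport a).isOpen_compl.mem_nhds hx] with y hy
      rw [image_eq_zero_of_notMem_tsupport hy, zero_mul]
    exact contDiffAt_const.congr_of_eventuallyEq this

lemma tsupport_dirDeriv_subset (e : E) (u : E → ℂ) : tsupport (dirDeriv e u) ⊆ tsupport u := by
  refine closure_minimal (fun x hx => ?_) (isClosed_tsupport u)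
  by_contra h
  refine hx ?_
  simp [dirDeriv, fderiv_of_notMem_tsupport (𝕜 := ℝ) h]

variable [MeasurableSpace E] [BorelSpace E] [FiniteDimensional ℝ E]

/-- One integration by parts, from `e^{ilψ} = (il ∂ψ)⁻¹ ∂(e^{ilψ})`. The compact support of `a`
inside `U` removes boundary terms and makes `a / ∂ψ` globally smooth. -/
lemma integral_exp_mul_eq (μ : Measure E) [μ.IsAddHaarMeasure] (hU : IsOpen U) {K : Set E}
    (hK : IsCompact K) (hKU : K ⊆ U) {e : E} {ψ a : E → ℂ} (hψ : ContDiffOn ℝ ∞ ψ U)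
    (hg : ∀ x ∈ U, dirDeriv e ψ x ≠ 0) (ha : ContDiff ℝ ∞ a) (hs : tsupport a ⊆ K)
    {l : ℝ} (hl : l ≠ 0) :
    ∫ x, Complex.exp (Complex.I * l * ψ x) * a x ∂μ =
      - (Complex.I * l)⁻¹ * ∫ x, Complex.exp (Complex.I * l * ψ x) *
        dirDeriv e (fun x => a x * (dirDeriv e ψ x)⁻¹) x ∂μ := by
  have hl' : Complex.I * (l : ℂ) ≠ 0 := by simp [hl]
  set f : E → ℂ := fun x => Complex.exp (Complex.I * l * ψ x) with hf
  set b : E → ℂ := fun x => a x * (dirDeriv e ψ x)⁻¹ with hb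
  have hfs : ContDiffOn ℝ ∞ f U := (contDiffOn_const.mul hψ).cexp
  have hgs : ContDiffOn ℝ ∞ (fun x => (dirDeriv e ψ x)⁻¹) U := (hψ.dirDeriv hU).inv hg
  have hbs : ContDiff ℝ ∞ b := contDiff_mul_of_tsupport_subset hU ha hgs (hs.trans hKU)
  have hbt : tsupport b ⊆ K := (tsupport_mul_subset_left).trans hs
  have hint : ∀ w z : E → ℂ, ContDiff ℝ ∞ w → tsupport w ⊆ K → ContDiffOn ℝ ∞ z U →
      Integrable (fun x => z x * w x) μ := by
    intro w z hw hwt hz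
    have h1 := contDiff_mul_of_tsupport_subset hU hw hz (hwt.trans hKU)
    have h2 : HasCompactSupport (fun x => w x * z x) :=
      hK.of_isClosed_subset (isClosed_tsupport _) ((tsupport_mul_subset_left).trans hwt)
    simpa [mul_comm] using h1.continuous.integrable_of_hasCompactSupport h2
  have hdb : ContDiff ℝ ∞ (dirDeriv e b) := (hbs.fderiv_right (by simp)).clm_apply contDiff_const
  have hfd : ∀ x ∈ U, fderiv ℝ f x e = Complex.I * l * dirDeriv e ψ x * f x := by
    intro x hx
    have h1 := (((hψ.differentiableAt_of_isOpen hU hx).hasFDerivAt.const_mul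
      (Complex.I * (l : ℂ))).cexp).fderiv
    rw [hf, h1]
    simp [dirDeriv]
    ring
  have ibp := integral_bilinear_hasFDerivAt_right_eq_neg_left_of_integrable (μ := μ)
    (f := f) (f' := fderiv ℝ f) (g := b) (g' := fderiv ℝ b) (v := e)
    (B := ContinuousLinearMap.mul ℝ ℂ)
    (hint b _ hbs hbt (hfs.dirDeriv (e := e) hU))
    (hint (dirDeriv e b) f hdb ((tsupport_dirDeriv_subset e b).trans hbt) hfs)
    (hint b f hbs hbt hfs)
    (fun x hx => (hfs.differentiableAt_of_isOpen hU (hKU (hbt hx))).hasFDerivAt)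
    (fun x _ => (hbs.differentiable (by simp) x).hasFDerivAt)
  simp only [ContinuousLinearMap.mul_apply'] at ibp
  have h2 : ∫ x, fderiv ℝ f x e * b x ∂μ = (Complex.I * l) * ∫ x, f x * a x ∂μ := by
    rw [← integral_const_mul]
    congr 1 with x
    by_cases hx : x ∈ tsupport a
    · have hxU := hKU (hs hx)
      rw [hfd x hxU, hb]
      field_simp [hg x hxU]
    · simp [hb, image_eq_zero_of_notMem_tsupport hx]
  have h3 : ∫ x, f x * dirDeriv e b x ∂μ = -((Complex.I * l) * ∫ x, f x * a x ∂μ) := by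
    rw [← h2, ← ibp]; rfl
  rw [h3, neg_mul_neg, inv_mul_cancel_left₀ hl']

/-- **Nonstationary phase**, uniformly over a family of phases and amplitudes whose phase
derivatives in the directions `e i` stay away from zero. -/
theorem norm_integral_exp_mul_le (μ : Measure E) [μ.IsAddHaarMeasure] (hU : IsOpen U) {K : Set E}
    (hK : IsCompact K) (hKU : K ⊆ U) {ψ : ι → E → ℂ} (hreal : ∀ i x, (ψ i x).im = 0)
    (hψ : ∀ i, ContDiffOn ℝ ∞ (ψ i) U)
    (hψb : ∀ n, BoundedDirDerivs U e n (fun i => dirDeriv (e i) (ψ i)))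
    {c : ℝ} (hc : 0 < c) (hlow : ∀ i, ∀ x ∈ U, c ≤ ‖dirDeriv (e i) (ψ i) x‖) (N : ℕ)
    (a : ι → E → ℂ) (ha : ∀ i, ContDiff ℝ ∞ (a i)) (has : ∀ i, tsupport (a i) ⊆ K)
    (hab : ∀ n, BoundedDirDerivs U e n a) :
    ∃ C : ℝ, 0 ≤ C ∧ ∀ i, ∀ l : ℝ, l ≠ 0 →
      ‖∫ x, Complex.exp (Complex.I * l * ψ i x) * a i x ∂μ‖ ≤ C / |l| ^ N := by
  have hne : ∀ i, ∀ x ∈ U, dirDeriv (e i) (ψ i) x ≠ 0 := fun i x hx =>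
    norm_pos_iff.1 (hc.trans_le (hlow i x hx))
  induction N generalizing a with
  | zero =>
    obtain ⟨C, hC⟩ := (hab 0).bounded
    refine ⟨|C| * μ.real K, by positivity, fun i l _ => ?_⟩
    have h1 : ∫ x, Complex.exp (Complex.I * l * ψ i x) * a i x ∂μ =
        ∫ x in K, Complex.exp (Complex.I * l * ψ i x) * a i x ∂μ := by
      refine (setIntegral_eq_integral_of_forall_compl_eq_zero fun x hx => ?_).symm
      rw [image_eq_zero_of_notMem_tsupport (fun h => hx (has i h)), mul_zero]
    rw [h1, pow_zero, div_one]
    refine norm_setIntegral_le_of_norm_le_const hK.measure_lt_top fun x hx => ?_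
    have h2 : ‖Complex.exp (Complex.I * l * ψ i x)‖ = 1 := by
      rw [Complex.norm_exp]
      simp [hreal i x]
    rw [norm_mul, h2, one_mul]
    exact (hC i x (hKU hx)).trans (le_abs_self C)
  | succ N ih =>
    have hgs : ∀ i, ContDiffOn ℝ ∞ (dirDeriv (e i) (ψ i)) U := fun i => (hψ i).dirDeriv hU
    have hgi : ∀ i, ContDiffOn ℝ ∞ (fun x => (dirDeriv (e i) (ψ i) x)⁻¹) U :=
      fun i => (hgs i).inv (hne i)
    have hbs : ∀ i, ContDiff ℝ ∞ (fun x => a i x * (dirDeriv (e i) (ψ i) x)⁻¹) := fun i =>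
      contDiff_mul_of_tsupport_subset hU (ha i) (hgi i) ((has i).trans hKU)
    -- Each integration by parts gains `|l|⁻¹` and replaces `a` by `∂(a / ∂ψ)`, which again is
    -- supported in `K` with uniformly bounded derivatives.
    obtain ⟨C, hC0, hC⟩ := ih
      (fun i => dirDeriv (e i) (fun x => a i x * (dirDeriv (e i) (ψ i) x)⁻¹))
      (fun i => ((hbs i).fderiv_right (by simp)).clm_apply contDiff_const)
      (fun i => ((tsupport_dirDeriv_subset _ _).trans tsupport_mul_subset_left).trans (has i))
      (fun n => ((hab (n + 1)).mul hU ((hψb (n + 1)).inv hU hgs hc hlow)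
        (fun i => (ha i).contDiffOn) hgi).2)
    refine ⟨C, hC0, fun i l hl => ?_⟩
    rw [integral_exp_mul_eq μ hU hK hKU (hψ i) (hne i) (ha i) (has i) hl, norm_mul]
    have h1 : ‖-(Complex.I * (l : ℂ))⁻¹‖ = |l|⁻¹ := by simp
    rw [h1, pow_succ]
    calc |l|⁻¹ * _ ≤ |l|⁻¹ * (C / |l| ^ N) :=
          mul_le_mul_of_nonneg_left (hC i l hl) (by positivity)
      _ = _ := by rw [div_mul_eq_div_div, inv_mul_eq_div]

end NonstationaryPhase

/-! ### Uniform derivative bounds for translates and difference quotients -/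

section DifferenceQuotients

variable {E : Type*} [NormedAddCommGroup E] [NormedSpace ℝ E] {ι : Type*}

lemma hasFDerivAt_iteratedFDeriv_apply {u : E → ℂ} (hu : ContDiff ℝ ∞ u) (k : ℕ) (e x : E) :
    HasFDerivAt (fun y => iteratedFDeriv ℝ k u y (fun _ => e))
      ((ContinuousMultilinearMap.apply ℝ (fun _ : Fin k => E) ℂ (fun _ => e)).comp
        (fderiv ℝ (iteratedFDeriv ℝ k u) x)) x := by
  have h1 : DifferentiableAt ℝ (iteratedFDeriv ℝ k u) x :=
    (hu.differentiable_iteratedFDeriv (by exact_mod_cast ENat.natCast_lt_top k)) x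
  exact (ContinuousMultilinearMap.apply ℝ (fun _ : Fin k => E) ℂ
    (fun _ => e)).hasFDerivAt.comp x h1.hasFDerivAt

lemma norm_iteratedFDeriv_apply_const_le {u : E → ℂ} {k : ℕ} {e x : E} (he : ‖e‖ ≤ 1) :
    ‖iteratedFDeriv ℝ k u x (fun _ => e)‖ ≤ ‖iteratedFDeriv ℝ k u x‖ := by
  refine (ContinuousMultilinearMap.le_opNorm _ _).trans ?_
  refine mul_le_of_le_one_right (norm_nonneg _) ?_
  exact Finset.prod_le_one (fun _ _ => norm_nonneg _) (fun _ _ => he)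

lemma exists_bound_iteratedFDeriv {u : E → ℂ} (hu : ContDiff ℝ ∞ u) (hc : HasCompactSupport u)
    (k : ℕ) : ∃ C : ℝ, ∀ x, ‖iteratedFDeriv ℝ k u x‖ ≤ C :=
  (hc.iteratedFDeriv k).exists_bound_of_continuous
    (hu.continuous_iteratedFDeriv (by exact_mod_cast le_top))

lemma BoundedDirDerivs.translate {u : E → ℂ} (hu : ContDiff ℝ ∞ u) (hc : HasCompactSupport u)
    (U : Set E) {e : ι → E} (he : ∀ i, ‖e i‖ ≤ 1) (h : ι → E) (n : ℕ) :
    BoundedDirDerivs U e n (fun i x => u (x + h i)) := by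
  -- Stated for all orders `k` at once, since one directional derivative raises `k` by one.
  have key : ∀ k, BoundedDirDerivs U e n
      (fun i x => iteratedFDeriv ℝ k u (x + h i) (fun _ => e i)) := by
    induction n with
    | zero =>
      intro k
      obtain ⟨C, hC⟩ := exists_bound_iteratedFDeriv hu hc k
      exact ⟨C, fun i x _ => (norm_iteratedFDeriv_apply_const_le (he i)).trans (hC _)⟩
    | succ n ih =>
      intro k
      refine ⟨(ih k).bounded, ?_⟩
      convert ih (k + 1) using 3 with i x
      have h1 := (hasFDerivAt_comp_add_right (h i)).2
        (hasFDerivAt_iteratedFDeriv_apply hu k (e i) (x + h i))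
      rw [dirDeriv, h1.fderiv, iteratedFDeriv_succ_apply_left]
      rfl
  simpa using key 0

/-- The mean value inequality for the `k`-th derivative makes the bounds independent of `h`. At `h i
= 0` the quotient is zero. -/
lemma BoundedDirDerivs.differenceQuotient {u : E → ℂ} (hu : ContDiff ℝ ∞ u)
    (hc : HasCompactSupport u) (U : Set E) {e : ι → E} (he : ∀ i, ‖e i‖ ≤ 1) (h : ι → E)
    (n : ℕ) :
    BoundedDirDerivs U e n (fun i x => (‖h i‖ : ℂ)⁻¹ * (u (x + h i) - u x)) := by
  have key : ∀ k, BoundedDirDerivs U e n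
      (fun i x => (‖h i‖ : ℂ)⁻¹ * (iteratedFDeriv ℝ k u (x + h i) (fun _ => e i) -
        iteratedFDeriv ℝ k u x (fun _ => e i))) := by
    induction n with
    | zero =>
      intro k
      obtain ⟨C, hC⟩ := exists_bound_iteratedFDeriv hu hc (k + 1)
      refine ⟨C, fun i x _ => ?_⟩
      have hC0 : 0 ≤ C := (norm_nonneg _).trans (hC 0)
      have h1 : ‖iteratedFDeriv ℝ k u (x + h i) - iteratedFDeriv ℝ k u x‖ ≤ C * ‖h i‖ := by
        have := convex_univ.norm_image_sub_le_of_norm_fderiv_le (𝕜 := ℝ)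
          (f := iteratedFDeriv ℝ k u) (C := C) (x := x) (y := x + h i)
          (fun y _ => (hu.differentiable_iteratedFDeriv (by exact_mod_cast ENat.natCast_lt_top k)) y)
          (fun y _ => by rw [norm_fderiv_iteratedFDeriv]; exact hC y) trivial trivial
        simpa using this
      have h2 : ‖iteratedFDeriv ℝ k u (x + h i) (fun _ => e i) -
          iteratedFDeriv ℝ k u x (fun _ => e i)‖ ≤ C * ‖h i‖ := by
        refine le_trans ?_ h1
        rw [← sub_apply]
        refine (ContinuousMultilinearMap.le_opNorm _ _).trans ?_
        refine mul_le_of_le_one_right (norm_nonneg _) ?_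
        exact Finset.prod_le_one (fun _ _ => norm_nonneg _) (fun _ _ => he i)
      rw [norm_mul, norm_inv, Complex.norm_real, norm_norm]
      rcases eq_or_ne (‖h i‖) 0 with h0 | h0
      · rw [h0]; simpa using hC0
      · rw [inv_mul_le_iff₀ (lt_of_le_of_ne (norm_nonneg _) h0.symm), mul_comm]
        exact h2
    | succ n ih =>
      intro k
      refine ⟨(ih k).bounded, ?_⟩
      convert ih (k + 1) using 3 with i x
      have h1 := (hasFDerivAt_comp_add_right (h i)).2
        (hasFDerivAt_iteratedFDeriv_apply hu k (e i) (x + h i))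
      have h2 := hasFDerivAt_iteratedFDeriv_apply hu k (e i) x
      rw [dirDeriv, ((h1.fun_sub h2).const_mul _).fderiv, iteratedFDeriv_succ_apply_left,
        iteratedFDeriv_succ_apply_left]
      rfl
  simpa using key 0

end DifferenceQuotients

/-! ### Gradient differences and autocorrelation -/

section Dispersive

variable {V : Type*} [NormedAddCommGroup V] [InnerProductSpace ℝ V] [FiniteDimensional ℝ V]

/-- In finite dimension an injective map is bounded below. Halving the constant makes the inequality
strict, so that a vector of the unit ball realises it. -/
lemma exists_direction_of_injective {L : V →L[ℝ] V →L[ℝ] ℝ} (hL : Function.Injective L) :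
    ∃ c : ℝ, 0 < c ∧ ∀ h, ∃ e : V, ‖e‖ ≤ 1 ∧ c * ‖h‖ ≤ |L h e| := by
  obtain ⟨K, hK, hKL⟩ := (L : V →ₗ[ℝ] V →L[ℝ] ℝ).exists_antilipschitzWith
    (LinearMap.ker_eq_bot.2 hL)
  have hK' : (0 : ℝ) < K := hK
  refine ⟨(2 * K)⁻¹, by positivity, fun h => ?_⟩
  rcases eq_or_ne h 0 with rfl | h0
  · exact ⟨0, by simp, by simp⟩
  have h1 : ‖h‖ ≤ K * ‖L h‖ := by
    have := hKL.le_mul_dist h 0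
    simpa using this
  have hpos : 0 < ‖h‖ := norm_pos_iff.2 h0
  have h2 : (2 * (K : ℝ))⁻¹ * ‖h‖ < ‖L h‖ := by
    rw [inv_mul_lt_iff₀ (by positivity)]
    nlinarith
  obtain ⟨e, he, he'⟩ := (L h).exists_lt_apply_of_lt_opNorm h2
  exact ⟨e, he.le, by simpa using he'.le⟩

/-- Strict differentiability of the gradient at `ξ₀`: its increments differ from the Hessian applied
to `h` by at most half of the Hessian's lower bound. The direction `e h` depends on `h` alone, not
on `x`. -/
lemma exists_uniform_lower_bound {Φ : V → ℝ} (hΦ : ContDiff ℝ ∞ Φ) {ξ₀ : V}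
    (hinj : Function.Injective (fderiv ℝ (fderiv ℝ Φ) ξ₀)) :
    ∃ c : ℝ, 0 < c ∧ ∃ δ : ℝ, 0 < δ ∧ ∃ e : V → V, (∀ h, ‖e h‖ ≤ 1) ∧
      ∀ h x, x ∈ Metric.ball ξ₀ δ → x + h ∈ Metric.ball ξ₀ δ →
        c * ‖h‖ ≤ |fderiv ℝ Φ (x + h) (e h) - fderiv ℝ Φ x (e h)| := by
  obtain ⟨c, hc, hdir⟩ := exists_direction_of_injective hinj
  choose e he1 he2 using hdir
  have hs : HasStrictFDerivAt (fderiv ℝ Φ) (fderiv ℝ (fderiv ℝ Φ) ξ₀) ξ₀ :=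
    ((hΦ.fderiv_right (m := ∞) (by simp)).contDiffAt).hasStrictFDerivAt (by simp)
  have ho := hs.isLittleO.def (c := c / 2) (by positivity)
  rw [nhds_prod_eq, Filter.Eventually, Filter.mem_prod_same_iff] at ho
  obtain ⟨t, ht, hto⟩ := ho
  obtain ⟨δ, hδ, hδt⟩ := Metric.mem_nhds_iff.1 ht
  refine ⟨c / 2, by positivity, δ, hδ, e, he1, fun h x hx hxh => ?_⟩
  have h1 : ‖fderiv ℝ Φ (x + h) - fderiv ℝ Φ x - fderiv ℝ (fderiv ℝ Φ) ξ₀ h‖ ≤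
      c / 2 * ‖h‖ := by
    have := hto (Set.mk_mem_prod (hδt hxh) (hδt hx))
    simpa using this
  have h2 : |(fderiv ℝ Φ (x + h) - fderiv ℝ Φ x - fderiv ℝ (fderiv ℝ Φ) ξ₀ h) (e h)| ≤
      c / 2 * ‖h‖ := by
    have := ContinuousLinearMap.le_opNorm
      (fderiv ℝ Φ (x + h) - fderiv ℝ Φ x - fderiv ℝ (fderiv ℝ Φ) ξ₀ h) (e h)
    rw [Real.norm_eq_abs] at this
    refine this.trans ((mul_le_of_le_one_right (norm_nonneg _) (he1 h)).trans h1)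
  simp only [sub_apply] at h2
  have h3 := he2 h
  rw [abs_le] at h2
  rcases abs_cases (fderiv ℝ (fderiv ℝ Φ) ξ₀ h (e h)) with ⟨h4, _⟩ | ⟨h4, _⟩ <;>
  rcases abs_cases (fderiv ℝ Φ (x + h) (e h) - fderiv ℝ Φ x (e h)) with ⟨h5, _⟩ | ⟨h5, _⟩ <;>
  linarith

variable [MeasurableSpace V] [BorelSpace V]

/-- The square of the Fourier integral of `m` is dominated by the integral of its
autocorrelation. -/
lemma sq_norm_fourierIntegral_le {m : V → ℂ} (hm : Continuous m) (hc : HasCompactSupport m)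
    (x : V) :
    ‖∫ ξ, Complex.exp (Complex.I * (inner ℝ ξ x : ℝ)) * m ξ‖ ^ 2 ≤
      ∫ h, ‖∫ ξ, m (ξ + h) * starRingEnd ℂ (m ξ)‖ := by
  set M : V → ℂ := fun ξ => Complex.exp (Complex.I * (inner ℝ ξ x : ℝ)) * m ξ with hM
  have hMc : Continuous M := by fun_prop
  have hMs : HasCompactSupport M := hc.mul_left
  have hMi : Integrable M := hMc.integrable_of_hasCompactSupport hMs
  -- Translation invariance turns the product of the two integrals into a double integral in `ξ` and
  -- the shift `h`.
  have h1 : (∫ ξ, M ξ) * starRingEnd ℂ (∫ ξ, M ξ) =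
      ∫ ξ, ∫ h, M (ξ + h) * starRingEnd ℂ (M ξ) := by
    rw [← integral_conj, ← integral_const_mul]
    congr 1 with ξ
    rw [integral_mul_const, integral_add_left_eq_self M ξ]
  have hint : Integrable (fun z : V × V => M (z.1 + z.2) * starRingEnd ℂ (M z.1))
      (volume.prod volume) := by
    refine Continuous.integrable_of_hasCompactSupport (by fun_prop) ?_
    let φ : V × V ≃ₜ V × V := Homeomorph.shearAddRight V
    have h2 : HasCompactSupport (fun z : V × V => M z.2 * starRingEnd ℂ (M z.1)) := by
      refine HasCompactSupport.intro (hMs.isCompact.prod hMs.isCompact) fun z hz => ?_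
      by_cases h : z.1 ∈ tsupport M
      · have : z.2 ∉ tsupport M := fun h' => hz ⟨h, h'⟩
        simp [image_eq_zero_of_notMem_tsupport this]
      · simp [image_eq_zero_of_notMem_tsupport h]
    exact h2.comp_homeomorph φ
  -- The modulation contributes only the unimodular constant `e^{i h·x}`, so the bound does not
  -- depend on `x`.
  have h2 : ∀ h, ‖∫ ξ, M (ξ + h) * starRingEnd ℂ (M ξ)‖ =
      ‖∫ ξ, m (ξ + h) * starRingEnd ℂ (m ξ)‖ := by
    intro h
    have h3 : ∀ ξ, M (ξ + h) * starRingEnd ℂ (M ξ) =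
        Complex.exp (Complex.I * (inner ℝ h x : ℝ)) * (m (ξ + h) * starRingEnd ℂ (m ξ)) := by
      intro ξ
      simp only [hM, map_mul, ← Complex.exp_conj, Complex.conj_I, Complex.conj_ofReal]
      rw [mul_mul_mul_comm, ← Complex.exp_add, inner_add_left]
      congr 2
      push_cast
      ring
    simp_rw [h3]
    rw [integral_const_mul, norm_mul, Complex.norm_exp]
    simp
  calc ‖∫ ξ, M ξ‖ ^ 2 = ‖(∫ ξ, M ξ) * starRingEnd ℂ (∫ ξ, M ξ)‖ := by
        rw [norm_mul, RCLike.norm_conj, sq]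
    _ = ‖∫ h, ∫ ξ, M (ξ + h) * starRingEnd ℂ (M ξ)‖ := by
        rw [h1, integral_integral_swap hint]
    _ ≤ ∫ h, ‖∫ ξ, M (ξ + h) * starRingEnd ℂ (M ξ)‖ := norm_integral_le_integral_norm _
    _ = _ := by simp_rw [h2]

end Dispersive

/-! ### The dispersive estimate -/

section Dispersive

variable {V : Type*} [NormedAddCommGroup V] [InnerProductSpace ℝ V] [FiniteDimensional ℝ V]
  [MeasurableSpace V] [BorelSpace V]

lemma exp_mul_conj_exp (a b t : ℝ) (z w : ℝ) :
    Complex.exp (Complex.I * t * a) * z * starRingEnd ℂ (Complex.exp (Complex.I * t * b) * w) =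
      Complex.exp (Complex.I * t * (a - b)) * (z * w) := by
  simp only [map_mul, ← Complex.exp_conj, Complex.conj_I, Complex.conj_ofReal]
  rw [mul_mul_mul_comm, ← Complex.exp_add]
  congr 2
  ring

/-- Decay of the autocorrelation of an oscillating bump at a point where the phase has a
nondegenerate second derivative. -/
lemma exists_autocorrelation_decay {Φ : V → ℝ} (hΦ : ContDiff ℝ ∞ Φ) (hc : HasCompactSupport Φ)
    {ξ₀ : V} (hinj : Function.Injective (fderiv ℝ (fderiv ℝ Φ) ξ₀)) {ε : ℝ} (hε : 0 < ε) :
    ∃ χ : V → ℝ, ContDiff ℝ ∞ χ ∧ HasCompactSupport χ ∧ tsupport χ ⊆ Metric.ball ξ₀ ε ∧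
      χ ξ₀ = 1 ∧ ∀ N : ℕ, ∃ C : ℝ, 0 ≤ C ∧ ∀ (t : ℝ) (h : V),
        ‖∫ ξ, (Complex.exp (Complex.I * t * Φ (ξ + h)) * χ (ξ + h)) *
          starRingEnd ℂ (Complex.exp (Complex.I * t * Φ ξ) * χ ξ)‖ ≤
            C * ((1 + |t| * ‖h‖) ^ N)⁻¹ := by
  obtain ⟨c, hc0, δ, hδ, e, he, hlow⟩ := exists_uniform_lower_bound hΦ hinj
  -- With `ρ ≤ δ / 8` the support of `χ` lies in `U`, and shifts with `‖h‖ > δ / 2` separate it from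
  -- its translate.
  set ρ : ℝ := min (δ / 8) (ε / 2) with hρ
  have hρ0 : 0 < ρ := by positivity
  have hρδ : ρ ≤ δ / 8 := min_le_left _ _
  have hρε : ρ ≤ ε / 2 := min_le_right _ _
  let χ : ContDiffBump ξ₀ := ⟨ρ / 2, ρ, by positivity, by linarith⟩
  have hχs : tsupport χ = Metric.closedBall ξ₀ ρ := χ.tsupport_eq
  have hχd : ContDiff ℝ ∞ χ := χ.contDiff
  refine ⟨χ, hχd, χ.hasCompactSupport, ?_, χ.eventuallyEq_one.self_of_nhds, fun N => ?_⟩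
  · rw [hχs]
    exact Metric.closedBall_subset_ball (by linarith)
  have hχi : Integrable (fun x => χ x) := hχd.continuous.integrable_of_hasCompactSupport
    χ.hasCompactSupport
  -- the trivial bound
  have htriv : ∀ (t : ℝ) (h : V), ‖∫ ξ, (Complex.exp (Complex.I * t * Φ (ξ + h)) * χ (ξ + h)) *
      starRingEnd ℂ (Complex.exp (Complex.I * t * Φ ξ) * χ ξ)‖ ≤ ∫ ξ, χ ξ := by
    intro t h
    refine (norm_integral_le_integral_norm _).trans
      (integral_mono_of_nonneg (Filter.Eventually.of_forall fun _ => norm_nonneg _) hχi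
        (Filter.Eventually.of_forall fun ξ => ?_))
    have h1 : ∀ s : ℝ, ‖Complex.exp (Complex.I * t * s)‖ = 1 := fun s => by
      rw [Complex.norm_exp]; simp
    simp only [norm_mul, RCLike.norm_conj, h1, one_mul, Complex.norm_real, Real.norm_eq_abs,
      abs_of_nonneg χ.nonneg]
    exact mul_le_of_le_one_left χ.nonneg χ.le_one
  -- the nonstationary phase bound
  let ι := {h : V // h ≠ 0 ∧ ‖h‖ ≤ δ / 2}
  let Φc : V → ℂ := fun x => (Φ x : ℂ)
  have hΦc : ContDiff ℝ ∞ Φc := Complex.ofRealCLM.contDiff.comp hΦ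
  have hΦcs : HasCompactSupport Φc := hc.comp_left (g := fun x : ℝ => (x : ℂ)) (by simp)
  let χc : V → ℂ := fun x => (χ x : ℂ)
  have hχc : ContDiff ℝ ∞ χc := Complex.ofRealCLM.contDiff.comp hχd
  have hχcs : HasCompactSupport χc :=
    χ.hasCompactSupport.comp_left (g := fun x : ℝ => (x : ℂ)) (by simp)
  have hχct : tsupport χc ⊆ Metric.closedBall ξ₀ ρ := by
    rw [← hχs]
    exact tsupport_comp_subset (g := fun x : ℝ => (x : ℂ)) (by simp) χ
  let U : Set V := Metric.ball ξ₀ (δ / 2)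
  let ψ : ι → V → ℂ := fun h x => (‖h.1‖ : ℂ)⁻¹ * (Φc (x + h.1) - Φc x)
  let a : ι → V → ℂ := fun h x => χc (x + h.1) * χc x
  have hψd : ∀ i, ContDiff ℝ ∞ (ψ i) := fun i =>
    contDiff_const.mul ((hΦc.comp (contDiff_id.add contDiff_const)).sub hΦc)
  have hχb : ∀ n, BoundedDirDerivs U (fun h : ι => e h.1) n (fun _ => χc) := fun n => by
    simpa using BoundedDirDerivs.translate hχc hχcs U (fun h : ι => he h.1) (fun _ : ι => 0) n
  obtain ⟨C, hC0, hC⟩ := norm_integral_exp_mul_le (volume : Measure V) (U := U)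
    (e := fun h : ι => e h.1) Metric.isOpen_ball (isCompact_closedBall ξ₀ ρ)
    (Metric.closedBall_subset_ball (by linarith)) (ψ := ψ)
    (by
      intro i x
      have : ψ i x = ((‖i.1‖⁻¹ * (Φ (x + i.1) - Φ x) : ℝ) : ℂ) := by simp [ψ, Φc]
      rw [this, Complex.ofReal_im])
    (fun i => (hψd i).contDiffOn)
    (fun n => (BoundedDirDerivs.differenceQuotient hΦc hΦcs U (fun h : ι => he h.1)
      (fun h : ι => h.1) (n + 1)).2) hc0
    (by
      intro i x hx
      have hd : ∀ y, HasFDerivAt Φc (Complex.ofRealCLM.comp (fderiv ℝ Φ y)) y := fun y =>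
        Complex.ofRealCLM.hasFDerivAt.comp y ((hΦ.differentiable (by simp)) y).hasFDerivAt
      have h1 := (((hasFDerivAt_comp_add_right i.1).2 (hd (x + i.1))).fun_sub (hd x)).const_mul
        ((‖i.1‖ : ℂ)⁻¹)
      have h2 : dirDeriv (e i.1) (ψ i) x = ((‖i.1‖⁻¹ *
          (fderiv ℝ Φ (x + i.1) (e i.1) - fderiv ℝ Φ x (e i.1)) : ℝ) : ℂ) := by
        rw [dirDeriv, h1.fderiv]
        simp
      have hpos : 0 < ‖i.1‖ := norm_pos_iff.2 i.2.1
      rw [h2, Complex.norm_real, Real.norm_eq_abs, abs_mul, abs_of_pos (inv_pos.2 hpos),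
        le_inv_mul_iff₀ hpos, mul_comm]
      have hx' : dist x ξ₀ < δ / 2 := hx
      refine hlow _ _ (Metric.mem_ball.2 (by linarith)) (Metric.mem_ball.2 ?_)
      have h3 : dist (x + i.1) ξ₀ ≤ dist x ξ₀ + ‖i.1‖ := by
        rw [dist_eq_norm, dist_eq_norm, add_sub_right_comm]
        exact norm_add_le _ _
      linarith [i.2.2])
    N a
    (fun i => (hχc.comp (contDiff_id.add contDiff_const)).mul hχc)
    (fun i => (tsupport_mul_subset_right).trans hχct)
    (fun n => (BoundedDirDerivs.translate hχc hχcs U (fun h : ι => he h.1)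
        (fun h : ι => h.1) n).mul Metric.isOpen_ball
      (hχb n)
      (fun i => (hχc.comp (contDiff_id.add contDiff_const)).contDiffOn)
      (fun i => hχc.contDiffOn))
  have hχ0 : 0 ≤ ∫ ξ, χ ξ := integral_nonneg fun _ => χ.nonneg
  refine ⟨((∫ ξ, χ ξ) + C) * 2 ^ N, by positivity, fun t h => ?_⟩
  have hth : 0 ≤ |t| * ‖h‖ := by positivity
  rw [← div_eq_mul_inv, le_div_iff₀ (by positivity)]
  -- Three ranges: the trivial bound for `|t| ‖h‖ ≤ 1`, nonstationary phase for the remaining `‖h‖ ≤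
  -- δ / 2`, and disjoint supports beyond.
  rcases le_or_gt (|t| * ‖h‖) 1 with h1 | h1
  · calc _ ≤ (∫ ξ, χ ξ) * (2 : ℝ) ^ N :=
          mul_le_mul (htriv t h) (pow_le_pow_left₀ (by positivity) (by linarith) _)
            (by positivity) hχ0
      _ ≤ _ := mul_le_mul_of_nonneg_right (by linarith) (by positivity)
  · rcases le_or_gt ‖h‖ (δ / 2) with h2 | h2
    · have hh : h ≠ 0 := by
        rintro rfl
        simp at h1
        linarith
      have hpos : 0 < ‖h‖ := norm_pos_iff.2 hh
      have ht : t ≠ 0 := by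
        rintro rfl
        simp at h1
        linarith
      have h3 := hC ⟨h, hh, h2⟩ (t * ‖h‖) (mul_ne_zero ht hpos.ne')
      have h4 : ∫ ξ, (Complex.exp (Complex.I * t * Φ (ξ + h)) * χ (ξ + h)) *
          starRingEnd ℂ (Complex.exp (Complex.I * t * Φ ξ) * χ ξ) =
          ∫ x, Complex.exp (Complex.I * (t * ‖h‖ : ℝ) * ψ ⟨h, hh, h2⟩ x) *
            a ⟨h, hh, h2⟩ x := by
        congr 1 with ξ
        rw [exp_mul_conj_exp]
        congr 2
        have : (‖h‖ : ℂ) ≠ 0 := by exact_mod_cast hpos.ne'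
        simp only [ψ, Φc]
        push_cast
        field_simp
      rw [h4]
      rw [abs_mul, abs_norm] at h3
      calc _ ≤ (C / (|t| * ‖h‖) ^ N) * (2 * (|t| * ‖h‖)) ^ N :=
            mul_le_mul h3 (pow_le_pow_left₀ (by positivity) (by linarith) _)
              (by positivity) (by positivity)
        _ = C * 2 ^ N := by
            have h5 : (|t| * ‖h‖) ^ N ≠ 0 := by positivity
            rw [mul_pow 2 (|t| * ‖h‖)]
            generalize (|t| * ‖h‖) ^ N = y at h5
            field_simp
        _ ≤ _ := mul_le_mul_of_nonneg_right (by linarith) (by positivity)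
    · have h4 : ∀ ξ, (Complex.exp (Complex.I * t * Φ (ξ + h)) * χ (ξ + h)) *
          starRingEnd ℂ (Complex.exp (Complex.I * t * Φ ξ) * χ ξ) = 0 := by
        intro ξ
        by_cases hξ : ξ ∈ Metric.closedBall ξ₀ ρ
        · have : ξ + h ∉ tsupport χ := by
            rw [hχs]
            intro h5
            have h6 : ‖h‖ ≤ dist (ξ + h) ξ₀ + dist ξ ξ₀ := by
              have := dist_triangle_right (ξ + h) ξ ξ₀
              simpa using this
            rw [Metric.mem_closedBall] at h5 hξ
            linarith
          simp [image_eq_zero_of_notMem_tsupport this]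
        · rw [← hχs] at hξ
          simp [image_eq_zero_of_notMem_tsupport hξ]
      simp_rw [h4]
      simp
      positivity

/-- **Dispersive estimate** near a point where the phase has a nondegenerate second derivative. -/
theorem exists_dispersive_bound {Φ : V → ℝ} (hΦ : ContDiff ℝ ∞ Φ) (hc : HasCompactSupport Φ)
    {ξ₀ : V} (hinj : Function.Injective (fderiv ℝ (fderiv ℝ Φ) ξ₀)) {ε : ℝ} (hε : 0 < ε) :
    ∃ χ : V → ℝ, ContDiff ℝ ∞ χ ∧ HasCompactSupport χ ∧ tsupport χ ⊆ Metric.ball ξ₀ ε ∧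
      χ ξ₀ = 1 ∧ ∃ C : ℝ, ∀ (t : ℝ) (x : V),
        ‖∫ ξ, Complex.exp (Complex.I * (inner ℝ ξ x : ℝ)) *
          (Complex.exp (Complex.I * t * Φ ξ) * χ ξ)‖ ^ 2 *
            japaneseBracket t ^ Module.finrank ℝ V ≤ C := by
  obtain ⟨χ, hχd, hχs, hχt, hχ1, hdec⟩ := exists_autocorrelation_decay hΦ hc hinj hε
  refine ⟨χ, hχd, hχs, hχt, hχ1, ?_⟩
  set d := Module.finrank ℝ V with hd
  -- Order `d + 1` makes the bound integrable in `h`; rescaling by `t` then yields the factor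
  -- `|t|^{-d}`.
  obtain ⟨C, hC0, hC⟩ := hdec (d + 1)
  have hJ : Integrable (fun h : V => ((1 + ‖h‖) ^ (d + 1))⁻¹) := by
    have := integrable_one_add_norm (μ := (volume : Measure V)) (r := (d + 1 : ℕ))
      (by exact_mod_cast Nat.lt_succ_self d)
    refine this.congr (Filter.Eventually.of_forall fun h => ?_)
    simp only
    rw [Real.rpow_neg (by positivity), Real.rpow_natCast]
  set J := ∫ h : V, ((1 + ‖h‖) ^ (d + 1))⁻¹ with hJd
  have hJ0 : 0 ≤ J := integral_nonneg fun h => by positivity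
  have hscale : ∀ t : ℝ, t ≠ 0 → Integrable (fun h : V => ((1 + |t| * ‖h‖) ^ (d + 1))⁻¹) ∧
      ∫ h : V, ((1 + |t| * ‖h‖) ^ (d + 1))⁻¹ = (|t| ^ d)⁻¹ * J := by
    intro t ht
    have h1 := hJ.comp_smul ht
    have h2 := Measure.integral_comp_smul (volume : Measure V)
      (fun h : V => ((1 + ‖h‖) ^ (d + 1))⁻¹) t
    simp only [norm_smul, Real.norm_eq_abs] at h1 h2
    refine ⟨h1, ?_⟩
    rw [h2, smul_eq_mul, abs_inv, abs_pow]
  set D := ∫ ξ, |χ ξ| with hD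
  have hD0 : 0 ≤ D := integral_nonneg fun h => abs_nonneg _
  have hnorm : ∀ s t : ℝ, ‖Complex.exp (Complex.I * t * s)‖ = 1 := fun s t => by
    rw [Complex.norm_exp]; simp
  have hnorm' : ∀ s : ℝ, ‖Complex.exp (Complex.I * s)‖ = 1 := fun s => by
    rw [Complex.norm_exp]; simp
  refine ⟨(D ^ 2 + C * J) * 2 ^ d, fun t x => ?_⟩
  have hjb : ∀ b : ℝ, 1 ≤ b → |t| ≤ b → japaneseBracket t ≤ 2 * b := by
    intro b hb htb
    rw [japaneseBracket, Real.sqrt_le_left (by positivity)]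
    nlinarith [abs_nonneg t]
  have hjb0 : 0 ≤ japaneseBracket t := Real.sqrt_nonneg _
  rcases le_or_gt |t| 1 with h1 | h1
  · have h2 : ‖∫ ξ, Complex.exp (Complex.I * (inner ℝ ξ x : ℝ)) *
          (Complex.exp (Complex.I * t * Φ ξ) * χ ξ)‖ ≤ D := by
      refine (norm_integral_le_integral_norm _).trans (le_of_eq ?_)
      congr 1 with ξ
      rw [norm_mul, norm_mul, hnorm, hnorm', Complex.norm_real, Real.norm_eq_abs]
      ring
    have h3 := hjb 1 le_rfl h1
    calc _ ≤ D ^ 2 * 2 ^ d := by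
          refine mul_le_mul (pow_le_pow_left₀ (norm_nonneg _) h2 2)
            (pow_le_pow_left₀ hjb0 (by linarith) _) (by positivity) (by positivity)
      _ ≤ _ := mul_le_mul_of_nonneg_right (by nlinarith [mul_nonneg hC0 hJ0]) (by positivity)
  · have ht : t ≠ 0 := by
      rintro rfl
      simp at h1
      linarith
    obtain ⟨hi, hv⟩ := hscale t ht
    have hm : Continuous fun ξ => Complex.exp (Complex.I * t * Φ ξ) * (χ ξ : ℂ) := by
      have := hΦ.continuous
      have := hχd.continuous
      fun_prop
    have hms : HasCompactSupport fun ξ => Complex.exp (Complex.I * t * Φ ξ) * (χ ξ : ℂ) :=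
      (hχs.comp_left (g := fun x : ℝ => (x : ℂ)) (by simp)).mul_left
    have h2 : ‖∫ ξ, Complex.exp (Complex.I * (inner ℝ ξ x : ℝ)) *
          (Complex.exp (Complex.I * t * Φ ξ) * χ ξ)‖ ^ 2 ≤ C * ((|t| ^ d)⁻¹ * J) := by
      refine (sq_norm_fourierIntegral_le hm hms x).trans ?_
      rw [← hv, ← integral_const_mul]
      exact integral_mono_of_nonneg (Filter.Eventually.of_forall fun _ => norm_nonneg _)
        (hi.const_mul C) (Filter.Eventually.of_forall fun h => hC t h)
    have h3 := hjb |t| h1.le le_rfl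
    calc _ ≤ C * ((|t| ^ d)⁻¹ * J) * (2 * |t|) ^ d :=
          mul_le_mul h2 (pow_le_pow_left₀ hjb0 h3 _) (by positivity) (by positivity)
      _ = C * J * 2 ^ d := by
          have : |t| ^ d ≠ 0 := by positivity
          rw [mul_pow]; field_simp
      _ ≤ _ := mul_le_mul_of_nonneg_right (by nlinarith [sq_nonneg D]) (by positivity)

end Dispersive

/-! ### Hessians of functions homogeneous of degree zero -/

section SecondDerivative

variable {V : Type*} [NormedAddCommGroup V] [InnerProductSpace ℝ V] {Φ : V → ℝ}

lemma differentiableAt_of_contDiffOn_compl_zero (hs : ContDiffOn ℝ ∞ Φ {0}ᶜ) {ξ : V}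
    (hξ : ξ ≠ 0) : DifferentiableAt ℝ Φ ξ :=
  (hs.contDiffAt (isOpen_compl_singleton.mem_nhds hξ)).differentiableAt (by simp)

lemma contDiffOn_fderiv_compl_zero (hs : ContDiffOn ℝ ∞ Φ {0}ᶜ) :
    ContDiffOn ℝ ∞ (fderiv ℝ Φ) {0}ᶜ :=
  hs.fderiv_of_isOpen isOpen_compl_singleton (by simp)

lemma hasFDerivAt_fderiv_of_contDiffOn (hs : ContDiffOn ℝ ∞ Φ {0}ᶜ) {ξ : V} (hξ : ξ ≠ 0) :
    HasFDerivAt (fderiv ℝ Φ) (fderiv ℝ (fderiv ℝ Φ) ξ) ξ :=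
  (((contDiffOn_fderiv_compl_zero hs).contDiffAt
    (isOpen_compl_singleton.mem_nhds hξ)).differentiableAt (by simp)).hasFDerivAt

/-- Euler's identity for functions homogeneous of degree zero. -/
lemma fderiv_apply_self_of_homogeneous (hs : ContDiffOn ℝ ∞ Φ {0}ᶜ)
    (hhom : ∀ r : ℝ, 0 < r → ∀ ξ : V, ξ ≠ 0 → Φ (r • ξ) = Φ ξ) {ξ : V} (hξ : ξ ≠ 0) :
    fderiv ℝ Φ ξ ξ = 0 := by
  have h1 : HasDerivAt (fun r : ℝ => r • ξ) ξ 1 := by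
    simpa using (hasDerivAt_id (1 : ℝ)).smul_const ξ
  have h2 : HasFDerivAt Φ (fderiv ℝ Φ ξ) ((fun r : ℝ => r • ξ) 1) := by
    simpa using (differentiableAt_of_contDiffOn_compl_zero hs hξ).hasFDerivAt
  have h3 := h2.comp_hasDerivAt (1 : ℝ) h1
  have h4 : HasDerivAt (Φ ∘ fun r : ℝ => r • ξ) 0 1 := by
    refine (hasDerivAt_const (1 : ℝ) (Φ ξ)).congr_of_eventuallyEq ?_
    filter_upwards [lt_mem_nhds (zero_lt_one : (0 : ℝ) < 1)] with r hr using hhom r hr ξ hξ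
  exact h3.unique h4

/-- Euler's identity differentiated in the direction `w`. -/
lemma fderiv_fderiv_apply_self_of_homogeneous (hs : ContDiffOn ℝ ∞ Φ {0}ᶜ)
    (hhom : ∀ r : ℝ, 0 < r → ∀ ξ : V, ξ ≠ 0 → Φ (r • ξ) = Φ ξ) {ξ : V} (hξ : ξ ≠ 0) (w : V) :
    fderiv ℝ (fderiv ℝ Φ) ξ w ξ = - fderiv ℝ Φ ξ w := by
  have h1 := (hasFDerivAt_fderiv_of_contDiffOn hs hξ).clm_apply (hasFDerivAt_id ξ)
  have h2 : HasFDerivAt (fun y => fderiv ℝ Φ y (id y)) (0 : V →L[ℝ] ℝ) ξ := by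
    refine (hasFDerivAt_const (0 : ℝ) ξ).congr_of_eventuallyEq ?_
    filter_upwards [isOpen_compl_singleton.mem_nhds hξ] with y hy
      using fderiv_apply_self_of_homogeneous hs hhom hy
  have h3 := congrArg (fun L : V →L[ℝ] ℝ => L w) (h1.unique h2)
  simp at h3
  linarith

lemma fderiv_fderiv_symm (hs : ContDiffOn ℝ ∞ Φ {0}ᶜ) {ξ : V} (hξ : ξ ≠ 0) (v w : V) :
    fderiv ℝ (fderiv ℝ Φ) ξ v w = fderiv ℝ (fderiv ℝ Φ) ξ w v := by
  have h := (hs.contDiffAt (isOpen_compl_singleton.mem_nhds hξ)).isSymmSndFDerivAt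
      (by rw [minSmoothness_of_isRCLikeNormedField]; exact WithTop.coe_le_coe.2 le_top)
  exact h v w

/-- With a negative second derivative, the restriction to a line would have a local maximum as well
as a local minimum. It would then be locally constant, with second derivative zero. -/
lemma fderiv_fderiv_nonneg_of_isLocalMin {q : V} (hΦ : ContDiffAt ℝ ∞ Φ q)
    (hmin : IsLocalMin Φ q) (v : V) : 0 ≤ fderiv ℝ (fderiv ℝ Φ) q v v := by
  by_contra! hneg
  set g : ℝ → ℝ := fun s => Φ (q + s • v) with hg
  have hline : ∀ s : ℝ, HasDerivAt (fun s : ℝ => q + s • v) v s := fun s => by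
    simpa using ((hasDerivAt_id s).smul_const v).const_add q
  have hcont : Filter.Tendsto (fun s : ℝ => q + s • v) (nhds 0) (nhds q) := by
    have : Continuous (fun s : ℝ => q + s • v) := by fun_prop
    simpa using this.tendsto 0
  have hdiff : ∀ᶠ y in nhds q, DifferentiableAt ℝ Φ y := by
    have := (hΦ.of_le (m := 1) (by simp)).eventually (by simp)
    filter_upwards [this] with y hy using hy.differentiableAt (by simp)
  have h1 : deriv g =ᶠ[nhds 0] fun s => fderiv ℝ Φ (q + s • v) v := by
    filter_upwards [hcont.eventually hdiff] with s hs
    exact (hs.hasFDerivAt.comp_hasDerivAt s (hline s)).deriv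
  have hd2 : HasFDerivAt (fderiv ℝ Φ) (fderiv ℝ (fderiv ℝ Φ) q) (q + (0 : ℝ) • v) := by
    rw [zero_smul, add_zero]
    exact ((hΦ.fderiv_right (m := ∞) (by simp)).differentiableAt (by simp)).hasFDerivAt
  have h2 : HasDerivAt (fun s : ℝ => fderiv ℝ Φ (q + s • v) v)
      (fderiv ℝ (fderiv ℝ Φ) q v v) 0 :=
    (ContinuousLinearMap.apply ℝ ℝ v).hasFDerivAt.comp_hasDerivAt (0 : ℝ)
      (hd2.comp_hasDerivAt (0 : ℝ) (hline 0))
  have h3 : deriv (deriv g) 0 = fderiv ℝ (fderiv ℝ Φ) q v v := by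
    rw [h1.deriv_eq, h2.deriv]
  have hgmin : IsLocalMin g 0 := by
    have : ∀ᶠ s : ℝ in nhds 0, Φ q ≤ Φ (q + s • v) := hcont.eventually hmin
    filter_upwards [this] with s hs
    simpa [hg] using hs
  have hgc : ContinuousAt g 0 := by
    have : ContinuousAt Φ (q + (0 : ℝ) • v) := by simpa using hΦ.continuousAt
    exact ContinuousAt.comp this (by fun_prop)
  have hgmax : IsLocalMax g 0 :=
    isLocalMax_of_deriv_deriv_neg (by rw [h3]; exact hneg) hgmin.deriv_eq_zero hgc
  have hconst : g =ᶠ[nhds 0] fun _ => g 0 := by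
    filter_upwards [hgmin, hgmax] with s ha hb using le_antisymm hb ha
  have h4 : deriv (deriv g) 0 = 0 := by
    rw [hconst.deriv.deriv_eq]
    simp
  rw [h3] at h4
  exact hneg.ne h4

lemma apply_eq_zero_of_apply_self_eq_zero {B : V →L[ℝ] V →L[ℝ] ℝ}
    (hsymm : ∀ v w, B v w = B w v) (hpos : ∀ v, 0 ≤ B v v) {u : V} (hu : B u u = 0) (v : V) :
    B v u = 0 := by
  by_contra hne
  -- The form is affine along `v + s u`; this `s` gives it the value `-1`.
  have h := hpos (v + (-(B v v + 1) / (2 * B v u)) • u)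
  simp only [map_add, map_smul, add_apply, smul_apply, smul_eq_mul, hu, hsymm u v] at h
  have h2 : -(B v v + 1) / (2 * B v u) * B v u = -(B v v + 1) / 2 := by field_simp
  simp only [h2, mul_zero, add_zero] at h
  linarith

lemma apply_eq_zero_of_isLocalExtr {q : V} (hΦ : ContDiffAt ℝ ∞ Φ q)
    (hext : IsLocalMin Φ q ∨ IsLocalMax Φ q) {u : V} (hu : fderiv ℝ (fderiv ℝ Φ) q u u = 0)
    (v : V) : fderiv ℝ (fderiv ℝ Φ) q v u = 0 := by
  have hsymm : ∀ v w, fderiv ℝ (fderiv ℝ Φ) q v w = fderiv ℝ (fderiv ℝ Φ) q w v :=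
    fun v w => hΦ.isSymmSndFDerivAt
      (by rw [minSmoothness_of_isRCLikeNormedField]; exact WithTop.coe_le_coe.2 le_top) v w
  rcases hext with hmin | hmax
  · exact apply_eq_zero_of_apply_self_eq_zero hsymm
      (fderiv_fderiv_nonneg_of_isLocalMin hΦ hmin) hu v
  · have h1 : fderiv ℝ (fderiv ℝ (fun x => -Φ x)) q = -fderiv ℝ (fderiv ℝ Φ) q := by
      have : fderiv ℝ (fun x => -Φ x) = fun x => -fderiv ℝ Φ x := by
        ext1 x
        exact fderiv_fun_neg
      rw [this]
      exact fderiv_fun_neg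
    have h2 := fderiv_fderiv_nonneg_of_isLocalMin hΦ.neg hmax.neg
    rw [h1] at h2
    have h3 := apply_eq_zero_of_apply_self_eq_zero (B := -fderiv ℝ (fderiv ℝ Φ) q)
      (fun v w => by simp [hsymm v w]) h2 (u := u) (by simp [hu]) v
    simpa using h3

/-- Criterion for the second derivative of a function homogeneous of degree zero to be
nondegenerate. -/
lemma injective_fderiv_fderiv_of_homogeneous (hs : ContDiffOn ℝ ∞ Φ {0}ᶜ)
    (hhom : ∀ r : ℝ, 0 < r → ∀ ξ : V, ξ ≠ 0 → Φ (r • ξ) = Φ ξ) {ξ q : V}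
    (hξq : inner ℝ q ξ ≠ 0)
    (hdef : ∀ u : V, inner ℝ q u = 0 → u ≠ 0 → fderiv ℝ (fderiv ℝ Φ) ξ u u ≠ 0)
    (hne : fderiv ℝ Φ ξ ≠ 0) : Function.Injective (fderiv ℝ (fderiv ℝ Φ) ξ) := by
  have hξ : ξ ≠ 0 := by
    rintro rfl
    simp at hξq
  rw [injective_iff_map_eq_zero]
  intro w hw
  have hsymm := fderiv_fderiv_symm hs hξ
  have heul := fderiv_fderiv_apply_self_of_homogeneous hs hhom hξ
  have hw1 : fderiv ℝ Φ ξ w = 0 := by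
    have := heul w
    rw [hw] at this
    simpa using this.symm
  -- A kernel vector splits as `w = u + a ξ` with `u ⊥ q`. Euler's identities give `B(u, u) = a
  -- dΦ(u) = 0`, so `u = 0` by definiteness; then `a ≠ 0` would force `dΦ(ξ) = 0`.
  set a : ℝ := inner ℝ q w / inner ℝ q ξ with ha
  set u : V := w - a • ξ with hu
  have hqu : inner ℝ q u = 0 := by
    rw [hu, inner_sub_right, inner_smul_right, ha]
    field_simp
    simp
  have hBu : fderiv ℝ (fderiv ℝ Φ) ξ u u = 0 := by
    have h1 : fderiv ℝ (fderiv ℝ Φ) ξ u u = -a * fderiv ℝ (fderiv ℝ Φ) ξ ξ u := by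
      have h2 : fderiv ℝ (fderiv ℝ Φ) ξ u = -a • fderiv ℝ (fderiv ℝ Φ) ξ ξ := by
        rw [hu, map_sub, hw, map_smul, zero_sub, neg_smul]
      rw [h2, smul_apply, smul_eq_mul]
    rw [h1, hsymm, heul, hu, map_sub, map_smul, hw1, fderiv_apply_self_of_homogeneous hs hhom hξ]
    simp
  have hu0 : u = 0 := by
    by_contra h
    exact hdef u hqu h hBu
  have hwa : w = a • ξ := sub_eq_zero.1 hu0
  by_cases ha0 : a = 0
  · rw [hwa, ha0, zero_smul]
  · exfalso
    refine hne (ContinuousLinearMap.ext fun v => ?_)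
    have h1 : fderiv ℝ (fderiv ℝ Φ) ξ v w = 0 := by
      rw [hsymm, hw]
      rfl
    rw [hwa, map_smul, heul, smul_eq_mul] at h1
    simpa [ha0] using h1

/-- A function homogeneous of degree zero has nondegenerate second derivative at points
arbitrarily close to a point where the second derivative is definite on the tangent space of the
sphere. -/
lemma exists_injective_fderiv_fderiv [FiniteDimensional ℝ V] (hs : ContDiffOn ℝ ∞ Φ {0}ᶜ)
    (hhom : ∀ r : ℝ, 0 < r → ∀ ξ : V, ξ ≠ 0 → Φ (r • ξ) = Φ ξ) {q : V} (hq : q ≠ 0)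
    (hdef : ∀ u : V, inner ℝ q u = 0 → u ≠ 0 → fderiv ℝ (fderiv ℝ Φ) q u u ≠ 0)
    (hu : ∃ u : V, inner ℝ q u = 0 ∧ u ≠ 0) :
    ∃ ξ : V, ξ ≠ 0 ∧ Function.Injective (fderiv ℝ (fderiv ℝ Φ) ξ) := by
  have hmin : ∃ c : ℝ, 0 < c ∧ ∀ u : V, inner ℝ q u = 0 → ‖u‖ = 1 →
      c ≤ |fderiv ℝ (fderiv ℝ Φ) q u u| := by
    have hK : IsCompact {u : V | inner ℝ q u = 0 ∧ ‖u‖ = 1} := by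
      refine (isCompact_sphere (0 : V) 1).of_isClosed_subset ?_ fun u hu => by
        simpa using hu.2
      exact (isClosed_eq (by fun_prop) continuous_const).inter
        (isClosed_eq continuous_norm continuous_const)
    obtain ⟨u₀, hu₀, hu₀'⟩ := hu
    have hne : {u : V | inner ℝ q u = 0 ∧ ‖u‖ = 1}.Nonempty :=
      ⟨‖u₀‖⁻¹ • u₀, by simp [inner_smul_right, hu₀], by
        rw [norm_smul, norm_inv, norm_norm, inv_mul_cancel₀ (norm_ne_zero_iff.2 hu₀')]⟩
    obtain ⟨u₁, hu₁, hmin⟩ := hK.exists_isMinOn hne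
      (f := fun u => |fderiv ℝ (fderiv ℝ Φ) q u u|) (by fun_prop)
    refine ⟨_, abs_pos.2 (hdef u₁ hu₁.1 ?_), fun u h1 h2 => hmin ⟨h1, h2⟩⟩
    rw [← norm_ne_zero_iff, hu₁.2]
    exact one_ne_zero
  obtain ⟨c, hc, hcb⟩ := hmin
  -- The lower bound `c` on the unit sphere of `q^⊥` survives a perturbation of the Hessian of norm
  -- less than `c`.
  have hnear : ∀ᶠ ξ in nhds q, inner ℝ q ξ ≠ 0 ∧
      ∀ u : V, inner ℝ q u = 0 → u ≠ 0 → fderiv ℝ (fderiv ℝ Φ) ξ u u ≠ 0 := by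
    have hc2 : ContinuousAt (fderiv ℝ (fderiv ℝ Φ)) q :=
      (((contDiffOn_fderiv_compl_zero hs).fderiv_of_isOpen (m := 0) isOpen_compl_singleton
        (by simp)).continuousOn).continuousAt (isOpen_compl_singleton.mem_nhds hq)
    have h1 : ∀ᶠ ξ in nhds q, inner ℝ q ξ ≠ 0 := by
      have : ContinuousAt (fun ξ : V => inner ℝ q ξ) q := by fun_prop
      exact this.eventually_ne (by simpa using hq)
    have h2 : ∀ᶠ ξ in nhds q, ‖fderiv ℝ (fderiv ℝ Φ) ξ - fderiv ℝ (fderiv ℝ Φ) q‖ < c := by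
      have h3 : ContinuousAt
          (fun ξ => ‖fderiv ℝ (fderiv ℝ Φ) ξ - fderiv ℝ (fderiv ℝ Φ) q‖) q :=
        (continuous_norm (E := V →L[ℝ] V →L[ℝ] ℝ)).continuousAt.comp
          (hc2.sub continuousAt_const)
      exact h3.eventually_lt_const (by
        beta_reduce
        rw [sub_self]
        exact (norm_zero (E := V →L[ℝ] V →L[ℝ] ℝ)).trans_lt hc)
    filter_upwards [h1, h2] with ξ h1 h2
    refine ⟨h1, fun u hqu hu0 h0 => ?_⟩
    have hpos : 0 < ‖u‖ := norm_pos_iff.2 hu0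
    set w : V := ‖u‖⁻¹ • u with hw
    have hw1 : ‖w‖ = 1 := by
      rw [hw, norm_smul, norm_inv, norm_norm, inv_mul_cancel₀ hpos.ne']
    have hw2 : fderiv ℝ (fderiv ℝ Φ) ξ w w = 0 := by simp [hw, h0]
    have h3 := hcb w (by simp [hw, inner_smul_right, hqu]) hw1
    have h4 : |(fderiv ℝ (fderiv ℝ Φ) ξ - fderiv ℝ (fderiv ℝ Φ) q) w w| ≤
        ‖fderiv ℝ (fderiv ℝ Φ) ξ - fderiv ℝ (fderiv ℝ Φ) q‖ := by
      have := ContinuousLinearMap.le_opNorm₂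
        (fderiv ℝ (fderiv ℝ Φ) ξ - fderiv ℝ (fderiv ℝ Φ) q) w w
      simpa [hw1] using this
    simp only [sub_apply, hw2, zero_sub, abs_neg] at h4
    linarith
  have hfreq : ∃ᶠ ξ in nhds q, fderiv ℝ Φ ξ ≠ 0 := by
    intro hev
    obtain ⟨u₀, hu₀, hu₀'⟩ := hu
    refine hdef u₀ hu₀ hu₀' ?_
    have h1 : fderiv ℝ Φ =ᶠ[nhds q] fun _ => 0 := by
      filter_upwards [hev] with ξ hξ using not_not.1 hξ
    rw [h1.fderiv_eq]
    simp
  obtain ⟨ξ, hξ, hξ1, hξ2⟩ := (hfreq.and_eventually hnear).exists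
  refine ⟨ξ, ?_, injective_fderiv_fderiv_of_homogeneous hs hhom hξ1 hξ2 hξ⟩
  rintro rfl
  simp at hξ1

end SecondDerivative

/-! ### From the sphere to the ambient space -/

section Sphere

variable {n : ℕ} {Φ : EuclideanSpace ℝ (Fin (n + 1)) → ℝ}

/-- The radial projection `ξ ↦ ξ / ‖ξ‖` is continuous at `q` and preserves `Φ`. -/
lemma isLocalExtr_of_sphere
    (hhom : ∀ r : ℝ, 0 < r → ∀ ξ : EuclideanSpace ℝ (Fin (n + 1)), ξ ≠ 0 → Φ (r • ξ) = Φ ξ)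
    {q : Metric.sphere (0 : EuclideanSpace ℝ (Fin (n + 1))) 1}
    (hext : IsLocalMin (fun q : Metric.sphere (0 : EuclideanSpace ℝ (Fin (n + 1))) 1 => Φ q) q ∨
      IsLocalMax (fun q : Metric.sphere (0 : EuclideanSpace ℝ (Fin (n + 1))) 1 => Φ q) q) :
    IsLocalMin Φ q ∨ IsLocalMax Φ q := by
  have hq1 : ‖(q : EuclideanSpace ℝ (Fin (n + 1)))‖ = 1 := by simp
  have hq0 : (q : EuclideanSpace ℝ (Fin (n + 1))) ≠ 0 := by
    rw [← norm_ne_zero_iff, hq1]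
    exact one_ne_zero
  have key : ∀ P : EuclideanSpace ℝ (Fin (n + 1)) → Prop,
      (∀ᶠ x : Metric.sphere (0 : EuclideanSpace ℝ (Fin (n + 1))) 1 in nhds q, P x) →
      ∀ᶠ ξ in nhds (q : EuclideanSpace ℝ (Fin (n + 1))), ξ ≠ 0 ∧ P (‖ξ‖⁻¹ • ξ) := by
    intro P hP
    rw [nhds_subtype_eq_comap, Filter.eventually_comap] at hP
    have hcont : Filter.Tendsto (fun ξ : EuclideanSpace ℝ (Fin (n + 1)) => ‖ξ‖⁻¹ • ξ)
        (nhds q) (nhds q) := by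
      have : ContinuousAt (fun ξ : EuclideanSpace ℝ (Fin (n + 1)) => ‖ξ‖⁻¹ • ξ) q :=
        (continuousAt_id.norm.inv₀ (by simp)).smul continuousAt_id
      simpa [ContinuousAt, hq1] using this
    filter_upwards [hcont.eventually hP, isOpen_compl_singleton.mem_nhds hq0] with ξ h1 h2
    have h3 : ‖ξ‖ ≠ 0 := norm_ne_zero_iff.2 h2
    exact ⟨h2, h1 ⟨‖ξ‖⁻¹ • ξ, by simp [norm_smul, h3]⟩ rfl⟩
  have hnorm : ∀ ξ : EuclideanSpace ℝ (Fin (n + 1)), ξ ≠ 0 → Φ (‖ξ‖⁻¹ • ξ) = Φ ξ := fun ξ hξ =>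
    hhom _ (inv_pos.2 (norm_pos_iff.2 hξ)) ξ hξ
  rcases hext with h | h
  · left
    filter_upwards [key (fun ξ => Φ q ≤ Φ ξ) h] with ξ hξ
    rw [← hnorm ξ hξ.1]
    exact hξ.2
  · right
    filter_upwards [key (fun ξ => Φ ξ ≤ Φ q) h] with ξ hξ
    rw [← hnorm ξ hξ.1]
    exact hξ.2

/-- Since `dΦ(q) = 0`, the Hessian in the chart is the pullback of the ambient one by the derivative
`L` of the parametrisation. Its invertibility makes `L` injective, hence onto `q^⊥` by dimension. At
an extremum the ambient Hessian is semidefinite, so a null vector `L a` lies in its kernel, which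
forces `a = 0`. -/
lemma fderiv_fderiv_ne_zero_of_nondegenerate (hs : ContDiffOn ℝ ∞ Φ {0}ᶜ)
    {q : Metric.sphere (0 : EuclideanSpace ℝ (Fin (n + 1))) 1}
    (hext : IsLocalMin Φ q ∨ IsLocalMax Φ q)
    (hnd : IsNondegenerateCriticalPoint (n := n)
      (fun q : Metric.sphere (0 : EuclideanSpace ℝ (Fin (n + 1))) 1 => Φ q) q)
    {u : EuclideanSpace ℝ (Fin (n + 1))}
    (hqu : inner ℝ (q : EuclideanSpace ℝ (Fin (n + 1))) u = 0) (hu : u ≠ 0) :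
    fderiv ℝ (fderiv ℝ Φ) q u u ≠ 0 := by
  obtain ⟨ψ, hψ, hqψ, -, hhess⟩ := hnd
  set y₀ := ψ q with hy₀
  have hy : y₀ ∈ ψ.target := ψ.map_source hqψ
  set σ : EuclideanSpace ℝ (Fin n) → EuclideanSpace ℝ (Fin (n + 1)) := fun y => ψ.symm y with hσ
  have hσ0 : σ y₀ = q := by simp [hσ, hy₀, ψ.left_inv hqψ]
  have hσ1 : ∀ y, ‖σ y‖ = 1 := fun y => by simp [hσ]
  have hσne : ∀ y, σ y ≠ 0 := fun y => by
    rw [← norm_ne_zero_iff, hσ1]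
    exact one_ne_zero
  have hσs : ContDiffOn ℝ ∞ σ ψ.target := by
    rw [← contMDiffOn_iff_contDiffOn]
    have : Fact (Module.finrank ℝ (EuclideanSpace ℝ (Fin (n + 1))) = n + 1) :=
      ⟨finrank_euclideanSpace_fin⟩
    exact (contMDiff_coe_sphere (n := n) (E := EuclideanSpace ℝ (Fin (n + 1)))).comp_contMDiffOn
      (contMDiffOn_symm_of_mem_maximalAtlas hψ)
  have hσd : ∀ y ∈ ψ.target, DifferentiableAt ℝ σ y := fun y hy =>
    (hσs.contDiffAt (ψ.open_target.mem_nhds hy)).differentiableAt (by simp)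
  set L := fderiv ℝ σ y₀ with hL
  set B := fderiv ℝ (fderiv ℝ Φ) (q : EuclideanSpace ℝ (Fin (n + 1))) with hB
  have hq0 : (q : EuclideanSpace ℝ (Fin (n + 1))) ≠ 0 := hσ0 ▸ hσne y₀
  have hcrit : fderiv ℝ Φ q = 0 := by
    rcases hext with h | h
    · exact h.fderiv_eq_zero
    · exact h.fderiv_eq_zero
  have hH : ∀ j k, hessianMatrix ((fun q : Metric.sphere (0 : EuclideanSpace ℝ (Fin (n + 1))) 1 =>
      Φ q) ∘ ψ.symm) y₀ j k =
      B (L (EuclideanSpace.single j 1)) (L (EuclideanSpace.single k 1)) := by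
    intro j k
    have h1 : (fun y => fderiv ℝ ((fun q : Metric.sphere (0 : EuclideanSpace ℝ (Fin (n + 1))) 1 =>
        Φ q) ∘ ψ.symm) y (EuclideanSpace.single k 1)) =ᶠ[nhds y₀]
        fun y => fderiv ℝ Φ (σ y) (fderiv ℝ σ y (EuclideanSpace.single k 1)) := by
      filter_upwards [ψ.open_target.mem_nhds hy] with y hy
      have := (differentiableAt_of_contDiffOn_compl_zero hs (hσne y)).hasFDerivAt.comp y
        (hσd y hy).hasFDerivAt
      rw [show ((fun q : Metric.sphere (0 : EuclideanSpace ℝ (Fin (n + 1))) 1 =>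
        Φ q) ∘ ψ.symm) = Φ ∘ σ from rfl, this.fderiv]
      rfl
    have h2 : HasFDerivAt (fun y => fderiv ℝ Φ (σ y)) (B.comp L) y₀ := by
      have h3 : HasFDerivAt (fderiv ℝ Φ) B (σ y₀) := by
        rw [hσ0]
        exact hasFDerivAt_fderiv_of_contDiffOn hs hq0
      exact h3.comp y₀ (hσd y₀ hy).hasFDerivAt
    have h4 : DifferentiableAt ℝ (fun y => fderiv ℝ σ y (EuclideanSpace.single k 1)) y₀ :=
      ((((hσs.fderiv_of_isOpen (m := ∞) ψ.open_target (by simp)).contDiffAt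
        (ψ.open_target.mem_nhds hy)).differentiableAt (by simp)).clm_apply
        (differentiableAt_const _))
    rw [hessianMatrix, Matrix.of_apply, h1.fderiv_eq, (h2.clm_apply h4.hasFDerivAt).fderiv]
    simp [hσ0, hcrit, hL]
  have hinj : ∀ a, (∀ v, B v (L a) = 0) → a = 0 := by
    intro a ha
    have h1 := Matrix.mulVec_injective_of_isUnit hhess
    have h2 : (hessianMatrix ((fun q : Metric.sphere (0 : EuclideanSpace ℝ (Fin (n + 1))) 1 =>
      Φ q) ∘ ψ.symm) y₀).mulVec (fun k => a k) = 0 := by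
      ext j
      simp only [Matrix.mulVec, dotProduct, hH, Pi.zero_apply]
      rw [← ha (L (EuclideanSpace.single j 1))]
      have h3 : a = ∑ k, a k • EuclideanSpace.single k (1 : ℝ) := by
        have := (EuclideanSpace.basisFun (Fin n) ℝ).sum_repr a
        simpa using this.symm
      conv_rhs => rw [h3]
      simp [map_sum, mul_comm]
    have h4 : (fun k => a k) = 0 := h1 (by rw [h2, Matrix.mulVec_zero])
    ext k
    exact congrFun h4 k
  have hLinj : Function.Injective L := by
    rw [injective_iff_map_eq_zero]
    intro a ha
    exact hinj a fun v => by rw [ha, map_zero]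
  have hrange : LinearMap.range (L : EuclideanSpace ℝ (Fin n) →ₗ[ℝ] EuclideanSpace ℝ (Fin (n + 1))) =
      (Submodule.span ℝ {(q : EuclideanSpace ℝ (Fin (n + 1)))})ᗮ := by
    apply Submodule.eq_of_le_of_finrank_eq
    · rintro _ ⟨a, rfl⟩
      rw [Submodule.mem_orthogonal_singleton_iff_inner_right]
      have h1 := ((hσd y₀ hy).hasFDerivAt.inner ℝ (hσd y₀ hy).hasFDerivAt)
      have h2 : HasFDerivAt (fun y => inner ℝ (σ y) (σ y)) (0 : _ →L[ℝ] ℝ) y₀ := by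
        have : (fun y => inner ℝ (σ y) (σ y)) = fun _ => (1 : ℝ) := by
          ext y
          rw [real_inner_self_eq_norm_sq, hσ1, one_pow]
        rw [this]
        exact hasFDerivAt_const _ _
      have h3 := congrArg (fun M : _ →L[ℝ] ℝ => M a) (h1.unique h2)
      simp [hσ0, real_inner_comm] at h3
      simp only [ContinuousLinearMap.coe_coe, hL]
      exact h3
    · rw [LinearMap.finrank_range_of_inj hLinj, finrank_euclideanSpace_fin]
      have : Fact (Module.finrank ℝ (EuclideanSpace ℝ (Fin (n + 1))) = n + 1) :=
        ⟨finrank_euclideanSpace_fin⟩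
      exact (Submodule.finrank_orthogonal_span_singleton (n := n) hq0).symm
  have hmem : u ∈ LinearMap.range (L : EuclideanSpace ℝ (Fin n) →ₗ[ℝ] EuclideanSpace ℝ (Fin (n + 1))) := by
    rw [hrange, Submodule.mem_orthogonal_singleton_iff_inner_right]
    exact hqu
  obtain ⟨a, rfl⟩ := hmem
  intro h0
  refine hu ?_
  have ha : a = 0 := hinj a fun v => apply_eq_zero_of_isLocalExtr
    (hs.contDiffAt (isOpen_compl_singleton.mem_nhds hq0)) hext h0 v
  rw [ha, map_zero]

theorem exists_injective_fderiv_fderiv_of_nondegenerate (hn : 1 ≤ n)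
    (hs : ContDiffOn ℝ ∞ Φ {0}ᶜ)
    (hhom : ∀ r : ℝ, 0 < r → ∀ ξ : EuclideanSpace ℝ (Fin (n + 1)), ξ ≠ 0 → Φ (r • ξ) = Φ ξ)
    (hext : HasNondegenerateLocalExtremum n
      (fun q : Metric.sphere (0 : EuclideanSpace ℝ (Fin (n + 1))) 1 => Φ q)) :
    ∃ ξ : EuclideanSpace ℝ (Fin (n + 1)), ξ ≠ 0 ∧
      Function.Injective (fderiv ℝ (fderiv ℝ Φ) ξ) := by
  obtain ⟨q, hq, hnd⟩ := hext
  have hq0 : (q : EuclideanSpace ℝ (Fin (n + 1))) ≠ 0 := by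
    rw [← norm_ne_zero_iff]
    simp
  have hloc := isLocalExtr_of_sphere hhom hq
  refine exists_injective_fderiv_fderiv hs hhom hq0
    (fun u h1 h2 => fderiv_fderiv_ne_zero_of_nondegenerate hs hloc hnd h1 h2) ?_
  have : Fact (Module.finrank ℝ (EuclideanSpace ℝ (Fin (n + 1))) = n + 1) :=
    ⟨finrank_euclideanSpace_fin⟩
  have hfin := Submodule.finrank_orthogonal_span_singleton (n := n) (𝕜 := ℝ) hq0
  -- The tangent space has dimension `n ≥ 1`.
  have hne : (Submodule.span ℝ {(q : EuclideanSpace ℝ (Fin (n + 1)))})ᗮ ≠ ⊥ := by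
    intro h
    rw [h, finrank_bot] at hfin
    omega
  obtain ⟨u, hu, hu0⟩ := Submodule.exists_mem_ne_zero_of_ne_bot hne
  exact ⟨u, Submodule.mem_orthogonal_singleton_iff_inner_right.1 hu, hu0⟩

end Sphere

/-! ### Schwartz functions with prescribed Fourier transform -/

section FourierSynthesis

open scoped FourierTransform

variable {d : ℕ}

/-- Plancherel's theorem for the inverse Fourier transform of Schwartz functions. -/
lemma eLpNorm_fourierInv (g : 𝓢(EuclideanSpace ℝ (Fin d), ℂ)) :
    eLpNorm (𝓕⁻ g : 𝓢(EuclideanSpace ℝ (Fin d), ℂ)) 2 volume = eLpNorm g 2 volume := by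
  have h1 := SchwartzMap.norm_fourier_toL2_eq (𝓕⁻ g)
  rw [FourierTransform.fourier_fourierInv_eq g, SchwartzMap.norm_toLp, SchwartzMap.norm_toLp] at h1
  exact ((ENNReal.toReal_eq_toReal_iff' (g.eLpNorm_lt_top 2 volume).ne
    ((𝓕⁻ g : 𝓢(EuclideanSpace ℝ (Fin d), ℂ)).eLpNorm_lt_top 2 volume).ne).1 h1).symm

/-- Every smooth compactly supported `m` is the Fourier transform of a Schwartz function, whose
`L²` norm is given by Plancherel's theorem. -/
lemma exists_schwartz_fourierHat_eq {m : EuclideanSpace ℝ (Fin d) → ℂ} (hm : ContDiff ℝ ∞ m)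
    (hc : HasCompactSupport m) :
    ∃ f : 𝓢(EuclideanSpace ℝ (Fin d), ℂ),
      (∀ x, f x = ∫ ξ, Complex.exp (Complex.I * (inner ℝ ξ x : ℝ)) * m ξ) ∧
      (∀ ξ, fourierHat f ξ = m ξ) ∧
      eLpNorm f 2 volume =
        eLpNorm (fun ζ => (2 * Real.pi : ℂ) ^ d * m ((2 * Real.pi) • ζ)) 2 volume := by
  have hpi : (2 * Real.pi : ℝ) ≠ 0 := by positivity
  have hpic : (2 * Real.pi : ℂ) ^ d ≠ 0 := by
    have : (Real.pi : ℂ) ≠ 0 := by exact_mod_cast Real.pi_ne_zero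
    exact pow_ne_zero _ (mul_ne_zero two_ne_zero this)
  -- The substitution `ξ = 2π ζ` passes to the transform `𝓕` with kernel `e^{-2πi x·ζ}`; the factor
  -- is the Jacobian.
  set M : EuclideanSpace ℝ (Fin d) → ℂ := fun ζ => (2 * Real.pi : ℂ) ^ d * m ((2 * Real.pi) • ζ)
    with hM
  have hMd : ContDiff ℝ ∞ M := contDiff_const.mul (hm.comp (contDiff_const_smul _))
  have hMc : HasCompactSupport M :=
    (hc.comp_homeomorph (Homeomorph.smulOfNeZero (2 * Real.pi) hpi)).mul_left
  let g : 𝓢(EuclideanSpace ℝ (Fin d), ℂ) := hMc.toSchwartzMap hMd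
  have hg : ∀ ζ, g ζ = M ζ := fun ζ => rfl
  have hFF : 𝓕 (𝓕⁻ g) = g := FourierTransform.fourier_fourierInv_eq g
  refine ⟨𝓕⁻ g, fun x => ?_, fun ξ => ?_, ?_⟩
  · rw [SchwartzMap.fourierInv_coe, Real.fourierInv_eq']
    have h1 := Measure.integral_comp_smul (volume : Measure (EuclideanSpace ℝ (Fin d)))
      (fun ξ => Complex.exp (Complex.I * (inner ℝ ξ x : ℝ)) * m ξ) (2 * Real.pi)
    rw [finrank_euclideanSpace_fin, abs_of_pos (by positivity)] at h1
    have h2 : ∀ v, Complex.exp (((2 * Real.pi * inner ℝ v x : ℝ) : ℂ) * Complex.I) • g v =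
        (2 * Real.pi : ℂ) ^ d * (Complex.exp (Complex.I *
          (inner ℝ ((2 * Real.pi) • v) x : ℝ)) * m ((2 * Real.pi) • v)) := by
      intro v
      rw [hg, hM, smul_eq_mul, real_inner_smul_left, mul_comm Complex.I]
      ring
    simp_rw [h2]
    rw [integral_const_mul, h1, Complex.real_smul]
    push_cast
    rw [mul_inv_cancel_left₀ hpic]
  · have h1 : 𝓕 (𝓕⁻ g) ((2 * Real.pi)⁻¹ • ξ) = M ((2 * Real.pi)⁻¹ • ξ) := by rw [hFF, hg]
    rw [SchwartzMap.fourier_coe, Real.fourier_eq'] at h1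
    have h2 : ∀ v, Complex.exp (((-2 * Real.pi * inner ℝ v ((2 * Real.pi)⁻¹ • ξ) : ℝ) : ℂ) *
        Complex.I) • (𝓕⁻ g) v =
        (𝓕⁻ g) v * Complex.exp (-(Complex.I * ((inner ℝ ξ v : ℝ) : ℂ))) := by
      intro v
      rw [smul_eq_mul, mul_comm, real_inner_smul_right, real_inner_comm]
      congr 2
      have : (-2 * Real.pi * ((2 * Real.pi)⁻¹ * inner ℝ ξ v) : ℝ) = -inner ℝ ξ v := by
        field_simp
      rw [this]
      push_cast
      ring
    simp_rw [h2] at h1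
    rw [fourierHat, h1, hM]
    simp only
    rw [smul_inv_smul₀ hpi]
    field_simp
  · exact eLpNorm_fourierInv g

lemma multiplierOp_eq {Φ : EuclideanSpace ℝ (Fin d) → ℝ} {t : ℝ}
    {f : 𝓢(EuclideanSpace ℝ (Fin d), ℂ)} {m : EuclideanSpace ℝ (Fin d) → ℂ}
    (hf : ∀ ξ, fourierHat f ξ = m ξ) (x : EuclideanSpace ℝ (Fin d)) :
    multiplierOp Φ t f x = ∫ ξ, Complex.exp (Complex.I * (inner ℝ ξ x : ℝ)) *
      (Complex.exp (Complex.I * t * Φ ξ) * m ξ) := by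
  rw [multiplierOp]
  congr 1 with ξ
  rw [hf, add_comm, Complex.exp_add]
  ring

lemma toReal_eLpNorm_pos {f : 𝓢(EuclideanSpace ℝ (Fin d), ℂ)} (hf : f ≠ 0) {r : ℝ} (hr : 0 < r) :
    0 < (eLpNorm f (ENNReal.ofReal r) volume).toReal := by
  refine ENNReal.toReal_pos (fun h => hf ?_) (f.eLpNorm_lt_top _ volume).ne
  rw [eLpNorm_eq_zero_iff f.continuous.aestronglyMeasurable (by simpa using hr)] at h
  have h1 : (f : EuclideanSpace ℝ (Fin d) → ℂ) = 0 :=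
    (f.continuous.ae_eq_iff_eq volume continuous_zero).1 h
  ext x
  exact congrFun h1 x

lemma ofReal_le_multiplierNorm {Φ : EuclideanSpace ℝ (Fin d) → ℝ} {t p c : ℝ}
    {f g : 𝓢(EuclideanSpace ℝ (Fin d), ℂ)} (hf : f ≠ 0) (hp : 0 < p)
    (hfg : multiplierOp Φ t f = g) (hc : 0 ≤ c)
    (h : c * (eLpNorm f (ENNReal.ofReal p) volume).toReal ≤
      (eLpNorm g (ENNReal.ofReal p) volume).toReal) :
    ENNReal.ofReal c ≤ multiplierNorm Φ t p := by
  have hff : eLpNorm f (ENNReal.ofReal p) volume ≠ ⊤ := (f.eLpNorm_lt_top _ volume).ne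
  have hgf : eLpNorm g (ENNReal.ofReal p) volume ≠ ⊤ := (g.eLpNorm_lt_top _ volume).ne
  have hne : eLpNorm f (ENNReal.ofReal p) volume ≠ 0 := fun h0 => by
    have := toReal_eLpNorm_pos hf hp
    rw [h0] at this
    exact lt_irrefl _ this
  have h1 : ENNReal.ofReal c ≤ eLpNorm (multiplierOp Φ t f) (ENNReal.ofReal p) volume /
      eLpNorm f (ENNReal.ofReal p) volume := by
    rw [hfg, ENNReal.le_div_iff_mul_le (Or.inl hne) (Or.inl hff),
      ← ENNReal.ofReal_toReal hff, ← ENNReal.ofReal_mul hc, ← ENNReal.ofReal_toReal hgf]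
    exact ENNReal.ofReal_le_ofReal h
  exact h1.trans (le_iSup₂ (f := fun (f : 𝓢(EuclideanSpace ℝ (Fin d), ℂ)) (_ : f ≠ 0) =>
    eLpNorm (multiplierOp Φ t f) (ENNReal.ofReal p) volume /
      eLpNorm f (ENNReal.ofReal p) volume) f hf)

end FourierSynthesis

/-! ### Comparison of `L^p`, `L²` and `L^∞` norms -/

section Interpolation

/-- A function bounded by `M` satisfies `‖f‖_r ^ r ≤ M ^ (r - p) ‖f‖_p ^ p` for `p ≤ r`. -/
lemma toReal_eLpNorm_rpow_le {α : Type*} [MeasurableSpace α] {μ : Measure α} {f : α → ℂ}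
    {p r : ℝ} (hp : 0 < p) (hpr : p ≤ r) {M : ℝ} (hM : ∀ x, ‖f x‖ ≤ M) (hM0 : 0 ≤ M)
    (hfp : eLpNorm f (ENNReal.ofReal p) μ ≠ ⊤) :
    (eLpNorm f (ENNReal.ofReal r) μ).toReal ^ r ≤
      M ^ (r - p) * (eLpNorm f (ENNReal.ofReal p) μ).toReal ^ p := by
  have key : ∀ s : ℝ, 0 < s → eLpNorm f (ENNReal.ofReal s) μ ^ s = ∫⁻ x, ‖f x‖ₑ ^ s ∂μ := by
    intro s hs
    rw [eLpNorm_eq_lintegral_rpow_enorm_toReal (by simpa using hs) ENNReal.ofReal_ne_top,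
      ENNReal.toReal_ofReal hs.le, ← ENNReal.rpow_mul, one_div_mul_cancel hs.ne',
      ENNReal.rpow_one]
  have hMt : ENNReal.ofReal M ^ (r - p) ≠ ⊤ :=
    ENNReal.rpow_ne_top_of_nonneg (by linarith) ENNReal.ofReal_ne_top
  have h1 : eLpNorm f (ENNReal.ofReal r) μ ^ r ≤
      ENNReal.ofReal M ^ (r - p) * eLpNorm f (ENNReal.ofReal p) μ ^ p := by
    rw [key p hp, key r (hp.trans_le hpr), ← lintegral_const_mul' _ _ hMt]
    refine lintegral_mono fun x => ?_
    have h2 : ‖f x‖ₑ ^ r = ‖f x‖ₑ ^ (r - p) * ‖f x‖ₑ ^ p := by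
      rw [← ENNReal.rpow_add_of_nonneg _ _ (by linarith) hp.le, sub_add_cancel]
    rw [h2]
    gcongr
    · rw [← ofReal_norm]
      exact ENNReal.ofReal_le_ofReal (hM x)
  have h3 := ENNReal.toReal_mono
    (ENNReal.mul_ne_top hMt (ENNReal.rpow_ne_top_of_nonneg hp.le hfp)) h1
  rwa [ENNReal.toReal_mul, ← ENNReal.toReal_rpow, ← ENNReal.toReal_rpow, ← ENNReal.toReal_rpow,
    ENNReal.toReal_ofReal hM0] at h3

end Interpolation

section RealEstimates

variable {p b C a y D : ℝ}

/-- Here `a` stands for the `L²` norm, `y` for the `L^p` norm, `b` for `⟨t⟩` and `D` for the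
dimension; the inequality is solved for `y` by taking `p`-th roots. -/
lemma lower_bound_of_interpolation (hp : 0 < p) (hb : 0 < b) (hC : 0 < C)
    (ha : 0 < a) (hy : 0 ≤ y) (h : a ^ (2 : ℝ) ≤ (C * b ^ (-(D / 2))) ^ (2 - p) * y ^ p) :
    (a ^ (2 : ℝ) / C ^ (2 - p)) ^ p⁻¹ * b ^ (D * (1 / p - 1 / 2)) ≤ y := by
  rw [← Real.rpow_le_rpow_iff (by positivity) hy hp, Real.mul_rpow (by positivity) (by positivity),
    Real.rpow_inv_rpow (by positivity) hp.ne', ← Real.rpow_mul hb.le]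
  rw [Real.mul_rpow hC.le (by positivity), ← Real.rpow_mul hb.le] at h
  have h1 : D * (1 / p - 1 / 2) * p = -(-(D / 2) * (2 - p)) := by field_simp
  rw [h1, Real.rpow_neg hb.le, ← div_eq_mul_inv, div_div, div_le_iff₀ (by positivity)]
  linarith

lemma upper_bound_of_interpolation (hp : 0 < p) (hb : 0 < b) (hC : 0 < C)
    (ha : 0 < a) (hy : 0 ≤ y) (h : y ^ p ≤ (C * b ^ (-(D / 2))) ^ (p - 2) * a ^ (2 : ℝ)) :
    y * b ^ (D * (1 / 2 - 1 / p)) ≤ (C ^ (p - 2) * a ^ (2 : ℝ)) ^ p⁻¹ := by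
  rw [← Real.rpow_le_rpow_iff (by positivity) (by positivity) hp,
    Real.mul_rpow (by positivity) (by positivity),
    Real.rpow_inv_rpow (by positivity) hp.ne', ← Real.rpow_mul hb.le]
  rw [Real.mul_rpow hC.le (by positivity), ← Real.rpow_mul hb.le] at h
  have h1 : D * (1 / 2 - 1 / p) * p = -(-(D / 2) * (p - 2)) := by field_simp
  rw [h1, Real.rpow_neg hb.le, ← div_eq_mul_inv, div_le_iff₀ (by positivity)]
  linarith

end RealEstimates

/-! ### The test family and the lower bound -/

/-- A test family for the multiplier operators: Schwartz functions whose supremum norms decay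
at the dispersive rate while their `L²` norms stay constant. -/
lemma exists_dispersive_family (n : ℕ) {Φ : EuclideanSpace ℝ (Fin (n + 1)) → ℝ}
    (hs : ContDiffOn ℝ ∞ Φ {0}ᶜ) {ξ₀ : EuclideanSpace ℝ (Fin (n + 1))} (hξ₀ : ξ₀ ≠ 0)
    (hinj : Function.Injective (fderiv ℝ (fderiv ℝ Φ) ξ₀)) :
    ∃ (K : ℝ → 𝓢(EuclideanSpace ℝ (Fin (n + 1)), ℂ)) (C : ℝ), 0 < C ∧ (∀ t, K t ≠ 0) ∧
      (∀ s t, multiplierOp Φ t (K s) = K (s + t)) ∧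
      (∀ t, eLpNorm (K t) 2 volume = eLpNorm (K 0) 2 volume) ∧
      ∀ t x, ‖K t x‖ ≤ C * japaneseBracket t ^ (-(((n + 1 : ℕ) : ℝ) / 2)) := by
  have hR : 0 < ‖ξ₀‖ := norm_pos_iff.2 hξ₀
  -- The cutoff removes the singularity of `Φ` at the origin and equals one on the ball of radius
  -- `‖ξ₀‖ / 4`, where `χ` will be supported.
  let η : ContDiffBump ξ₀ := ⟨‖ξ₀‖ / 4, ‖ξ₀‖ / 2, by positivity, by linarith⟩
  have h0 : (0 : EuclideanSpace ℝ (Fin (n + 1))) ∉ tsupport η := by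
    rw [η.tsupport_eq, Metric.mem_closedBall, dist_zero_left]
    change ¬ (‖ξ₀‖ ≤ ‖ξ₀‖ / 2)
    linarith
  set Ψ : EuclideanSpace ℝ (Fin (n + 1)) → ℝ := fun ξ => η ξ * Φ ξ with hΨ
  have hΨd : ContDiff ℝ ∞ Ψ := by
    rw [contDiff_iff_contDiffAt]
    intro x
    by_cases hx : x = 0
    · have : Ψ =ᶠ[nhds x] fun _ => 0 := by
        filter_upwards [(isClosed_tsupport η).isOpen_compl.mem_nhds (hx ▸ h0)] with y hy
        simp [hΨ, image_eq_zero_of_notMem_tsupport hy]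
      exact contDiffAt_const.congr_of_eventuallyEq this
    · exact η.contDiff.contDiffAt.mul (hs.contDiffAt (isOpen_compl_singleton.mem_nhds hx))
  have hΨc : HasCompactSupport Ψ := η.hasCompactSupport.mul_right
  have hΨeq : Ψ =ᶠ[nhds ξ₀] Φ := by
    filter_upwards [η.eventuallyEq_one] with y hy
    simp [hΨ, hy]
  have hΨinj : Function.Injective (fderiv ℝ (fderiv ℝ Ψ) ξ₀) := by
    rwa [hΨeq.fderiv.fderiv_eq]
  obtain ⟨χ, hχd, hχc, hχs, hχ1, C, hC⟩ :=
    exists_dispersive_bound hΨd hΨc hΨinj (ε := ‖ξ₀‖ / 4) (by positivity)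
  have hχΦ : ∀ (t : ℝ) ξ, Complex.exp (Complex.I * t * Φ ξ) * (χ ξ : ℂ) =
      Complex.exp (Complex.I * t * Ψ ξ) * χ ξ := by
    intro t ξ
    by_cases hξ : ξ ∈ tsupport χ
    · have : η ξ = 1 := η.one_of_mem_closedBall (Metric.ball_subset_closedBall (hχs hξ))
      simp [hΨ, this]
    · simp [image_eq_zero_of_notMem_tsupport hξ]
  have hmd : ∀ t : ℝ, ContDiff ℝ ∞ (fun ξ => Complex.exp (Complex.I * t * Ψ ξ) * (χ ξ : ℂ)) :=
    fun t => (contDiff_const.mul (Complex.ofRealCLM.contDiff.comp hΨd)).cexp.mul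
      (Complex.ofRealCLM.contDiff.comp hχd)
  have hmc : ∀ t : ℝ, HasCompactSupport
      (fun ξ => Complex.exp (Complex.I * t * Ψ ξ) * (χ ξ : ℂ)) := fun t =>
    (hχc.comp_left (g := fun x : ℝ => (x : ℂ)) (by simp)).mul_left
  choose K hK1 hK2 hK3 using fun t => exists_schwartz_fourierHat_eq (hmd t) (hmc t)
  have hnorm : ∀ s t : ℝ, ‖Complex.exp (Complex.I * t * s)‖ = 1 := fun s t => by
    rw [Complex.norm_exp]; simp
  refine ⟨K, Real.sqrt (|C| + 1), by positivity, fun t h => ?_, fun s t => ?_, fun t => ?_,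
    fun t x => ?_⟩
  · have h1 := hK2 t ξ₀
    rw [h, hχ1] at h1
    simp only [fourierHat, FunLike.coe_zero, Pi.zero_apply, zero_mul, integral_zero, mul_zero,
      Complex.ofReal_one, mul_one] at h1
    exact Complex.exp_ne_zero _ h1.symm
  · ext x
    rw [multiplierOp_eq (hK2 s), hK1]
    congr 1 with ξ
    rw [mul_left_comm (Complex.exp (Complex.I * t * Φ ξ)), hχΦ t,
      ← mul_assoc (Complex.exp (Complex.I * s * Ψ ξ)), ← Complex.exp_add]
    congr 3
    push_cast
    ring
  -- By Plancherel the norm depends only on the modulus of the symbol, which is `|χ|` for every `t`.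
  · rw [hK3, hK3]
    refine eLpNorm_congr_norm_ae (Filter.Eventually.of_forall fun ζ => ?_)
    simp only [norm_mul, hnorm]
  · have h1 := hC t x
    rw [← hK1, finrank_euclideanSpace_fin] at h1
    have hb : 0 < japaneseBracket t := Real.sqrt_pos.2 (by positivity)
    rw [Real.rpow_neg hb.le, ← div_eq_mul_inv, le_div_iff₀ (by positivity)]
    apply Real.le_sqrt_of_sq_le
    rw [mul_pow, ← Real.rpow_mul_natCast hb.le]
    have h2 : (((n + 1 : ℕ) : ℝ) / 2 * (2 : ℕ)) = ((n + 1 : ℕ) : ℝ) := by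
      push_cast
      ring
    rw [h2, Real.rpow_natCast]
    linarith [le_abs_self C]

theorem theorem3 (n : ℕ) (hn : 1 ≤ n) (p : ℝ) (hp : 1 < p)
    (Φ : EuclideanSpace ℝ (Fin (n + 1)) → ℝ)
    (hsmooth : ContDiffOn ℝ ∞ Φ {0}ᶜ)
    (hhom : ∀ r : ℝ, 0 < r → ∀ ξ : EuclideanSpace ℝ (Fin (n + 1)), ξ ≠ 0 → Φ (r • ξ) = Φ ξ)
    (hext : HasNondegenerateLocalExtremum n
      (fun q : Metric.sphere (0 : EuclideanSpace ℝ (Fin (n + 1))) 1 => Φ q)) :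
    ∃ c : ℝ, 0 < c ∧ ∀ t : ℝ,
      ENNReal.ofReal (c * japaneseBracket t ^ (((n + 1 : ℕ) : ℝ) * |1 / 2 - 1 / p|)) ≤
        multiplierNorm Φ t p := by
  obtain ⟨ξ₀, hξ₀, hinj⟩ := exists_injective_fderiv_fderiv_of_nondegenerate hn hsmooth hhom hext
  obtain ⟨K, C, hC, hK0, hKT, hK2, hKb⟩ := exists_dispersive_family n hsmooth hξ₀ hinj
  have hp0 : 0 < p := by linarith
  have hfin : ∀ t (r : ℝ≥0∞), eLpNorm (K t) r volume ≠ ⊤ := fun t r =>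
    ((K t).eLpNorm_lt_top r volume).ne
  have hpos : ∀ t (r : ℝ), 0 < r → 0 < (eLpNorm (K t) (ENNReal.ofReal r) volume).toReal :=
    fun t r hr => toReal_eLpNorm_pos (hK0 t) hr
  have hb : ∀ t, 0 < japaneseBracket t := fun t => Real.sqrt_pos.2 (by positivity)
  have h2 : ENNReal.ofReal 2 = 2 := by simp
  set a := (eLpNorm (K 0) (ENNReal.ofReal 2) volume).toReal with ha
  have ha0 : 0 < a := hpos 0 2 (by norm_num)
  have hKa : ∀ t, (eLpNorm (K t) (ENNReal.ofReal 2) volume).toReal = a := fun t => by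
    rw [ha, h2, hK2 t]
  have hratio : ∀ (s t c : ℝ), 0 ≤ c →
      c * (eLpNorm (K s) (ENNReal.ofReal p) volume).toReal ≤
        (eLpNorm (K (s + t)) (ENNReal.ofReal p) volume).toReal →
      ENNReal.ofReal c ≤ multiplierNorm Φ t p := by
    intro s t c hc h
    exact ofReal_le_multiplierNorm (hK0 s) hp0 (hKT s t) hc h
  have hn0 := hpos 0 p hp0
  set n₀ := (eLpNorm (K 0) (ENNReal.ofReal p) volume).toReal with hn₀
  rcases le_total p 2 with hp2 | hp2
  -- For `p ≤ 2` dispersion enlarges the `L^p` norm: `K 0` is carried to `K t`.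
  · refine ⟨(a ^ (2 : ℝ) / C ^ (2 - p)) ^ p⁻¹ / n₀, by positivity, fun t => ?_⟩
    have hbt := hb t
    refine hratio 0 t _ (by positivity) ?_
    rw [zero_add, ← hn₀, abs_of_nonpos (by
      rw [sub_nonpos]; exact one_div_le_one_div_of_le hp0 hp2), neg_sub]
    have h3 := toReal_eLpNorm_rpow_le hp0 hp2 (hKb t) (by positivity) (hfin t _)
    rw [hKa] at h3
    have h4 := lower_bound_of_interpolation hp0 hbt hC ha0 ENNReal.toReal_nonneg h3
    calc _ = _ := by field_simp
      _ ≤ _ := h4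
  -- For `p ≥ 2` dispersed functions have small `L^p` norm: `K (-t)` is refocused to `K 0`.
  · refine ⟨n₀ / (C ^ (p - 2) * a ^ (2 : ℝ)) ^ p⁻¹, by positivity, fun t => ?_⟩
    have hbt := hb t
    have hbneg : japaneseBracket (-t) = japaneseBracket t := by simp [japaneseBracket]
    refine hratio (-t) t _ (by positivity) ?_
    rw [neg_add_cancel, ← hn₀, abs_of_nonneg (by
      rw [sub_nonneg]; exact one_div_le_one_div_of_le (by norm_num) hp2)]
    have h3 := toReal_eLpNorm_rpow_le (p := 2) (by norm_num) hp2 (hKb (-t))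
      (by rw [hbneg]; positivity) (hfin (-t) _)
    rw [hKa, hbneg] at h3
    have h4 := upper_bound_of_interpolation hp0 hbt hC ha0 ENNReal.toReal_nonneg h3
    rw [div_mul_eq_mul_div, div_mul_eq_mul_div, div_le_iff₀ (by positivity), mul_assoc]
    refine mul_le_mul_of_nonneg_left ?_ hn0.le
    rw [mul_comm]
    exact h4
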